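/- Let $\widetilde V\subseteq\mathbb R^3$ be open, invariant under rotations about the $\tilde z$-axis, with $\Lambda=0\in\widetilde V$; write points as $(\tilde\rho\cos\varphi,\tilde\rho\sin\varphi,\tilde z)$ and put $V=\widetilde V\setminus\{\Lambda\}$. Let $g_{ab}$ be a smooth metric of signature $(-,+,+,+)$ on $\mathbb R\times V$ that is stationary (with timelike Killing field $\xi=\partial_t$) and axisymmetric. Put $\lambda=-\xi^a\xi_a$, $h_{ab}=\lambda g_{ab}+\xi_a\xi_b$ (the metric on the manifold $V$ of Killing trajectories), and let $\omega$ be a smooth axisymmetric twist potential on $V$, $\nabla_a\omega=\epsilon_{abcd}\xi^b\nabla^c\xi^d$. Suppose the spacetime is asymptotically flat: there is a smooth $\Omega$ on $\widetilde V$, positive on $V$, such that $\tilde h_{ab}=\Omega^2h_{ab}$ extends to a smooth Riemannian metric on $\widetilde V$, with derivative operator $\tilde D_a$ and Ricci tensor $\widetilde R_{ab}$, and such that $\Omega=0$, $\tilde D_a\Omega=0$, $\tilde D_a\tilde D_b\Omega=2\tilde h_{ab}$ at $\Lambda$; and suppose that $\tilde\phi=\phi/\sqrt\Omega$ extends smoothly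 to $\Lambda$, where $\phi=\frac{\lambda^2+\omega^2-1}{4\lambda}+i\frac{\omega}{2\lambda}$. Assume finally that $$\tilde h_{ab}\sim e^{2\kappa}\left(\tilde\rho^2e^{-2\beta}d\varphi^2+d\tilde\rho^2+d\tilde z^2\right)$$ with smooth axisymmetric functions $\kappa,\beta$ on $\widetilde V$, $\kappa(\Lambda)=0$. Let $C[\,\cdot\,]$ denote the totally symmetric trace-free part with respect to $\tilde h_{ab}$, and define the Geroch--Hansen tensors on $\widetilde V$ by $P=\tilde\phi$ and, for $n\ge1$, $$P_{a_1\ldots a_n}=C\left[\tilde D_{a_1}P_{a_2\ldots a_n}-\tfrac{(n-1)(2n-3)}2\widetilde R_{a_1a_2}P_{a_3\ldots a_n}\right]$$ (the second term is absent for $n=1$). On the meridian plane of angle $\varphi$, with Cartesian coordinates $(\tilde z,\tilde\rho)$ ($\tilde\rho$ of either sign, so that $(\tilde z,\tilde\rho)$ denotes the point $(\tilde\rho\cos\varphi,\tilde\rho\sin\varphi,\tilde z)$), put $\eta^a=(\partial/\partial\tilde z)^a-i(\partial/\partial\tilde\rho)^a$ and $f_n=\eta^{a_1}\cdots\eta^{a_n}P_{a_1\ldots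 a_n}$ for $n\ge0$. Then: 1. Each $f_n$ is a smooth function of $(\tilde z,\tilde\rho)$, and it is the same function for every $\varphi$. 2. For all $n\ge1$, on the whole part of the meridian plane in $\widetilde V$ (including the axis and $\Lambda$), $$f_n=\eta^a\tilde D_af_{n-1}-2(n-1)f_{n-1}\,\eta^a\tilde D_a\kappa-\tfrac{(n-1)(2n-3)}2\,\eta^a\eta^b\widetilde R_{ab}\,f_{n-2},$$ where $\eta^a\tilde D_aF=\partial F/\partial\tilde z-i\,\partial F/\partial\tilde\rho$ for functions $F$ of $(\tilde z,\tilde\rho)$ (the last term is absent for $n=1$). 3. For every $n\ge0$ there is exactly one $m_n\in\mathbb C$ (the $n$-th multipole moment) with $P_{a_1\ldots a_n}(\Lambda)=m_n\,C[z_{a_1}\cdots z_{a_n}]$ at $\Lambda$, where $z_a=(d\tilde z)_a$, and $m_n=f_n(\Lambda)$. -/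

import Mathlib

open scoped ContDiff

namespace GerochHansen

noncomputable section

/-! ### Tensor calculus in a coordinate chart -/

/-- Components of a covariant tensor of rank `n` at a point; indices range over `ι`, values in `F`. -/
abbrev Tensor (ι F : Type) (n : ℕ) : Type := (Fin n → ι) → F

/-- The `i`-th coordinate partial derivative. -/
def pderiv {ι F : Type} [Fintype ι] [DecidableEq ι] [NormedAddCommGroup F] [NormedSpace ℝ F]
    (i : ι) (f : (ι → ℝ) → F) (x : ι → ℝ) : F :=
  fderiv ℝ f x (Pi.single i 1)

/-- Christoffel symbols `Γ^k_{ij}` of the Levi-Civita connection of the metric `G`. -/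
def christoffel {ι : Type} [Fintype ι] [DecidableEq ι] (G : (ι → ℝ) → Matrix ι ι ℝ)
    (k i j : ι) (x : ι → ℝ) : ℝ :=
  (1 / 2) * ∑ l, (G x)⁻¹ k l *
    (pderiv i (fun y => G y l j) x + pderiv j (fun y => G y l i) x - pderiv l (fun y => G y i j) x)

/-- Covariant derivative; the new index comes first:
`(covDeriv G T)_{a₀ a₁ … aₙ} = D_{a₀} T_{a₁ … aₙ}`. -/
def covDeriv {ι F : Type} [Fintype ι] [DecidableEq ι] [NormedAddCommGroup F] [NormedSpace ℝ F]
    (G : (ι → ℝ) → Matrix ι ι ℝ) {n : ℕ} (T : (ι → ℝ) → Tensor ι F n) :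
    (ι → ℝ) → Tensor ι F (n + 1) :=
  fun x I => pderiv (I 0) (fun y => T y (Fin.tail I)) x -
    ∑ k : Fin n, ∑ j : ι,
      christoffel G j (I 0) (Fin.tail I k) x • T x (Function.update (Fin.tail I) k j)

/-- Ricci tensor of `G` (the sign for which round spheres have positive Ricci curvature). -/
def ricci {ι : Type} [Fintype ι] [DecidableEq ι] (G : (ι → ℝ) → Matrix ι ι ℝ)
    (x : ι → ℝ) (i j : ι) : ℝ :=
  ∑ k, (pderiv k (christoffel G k i j) x - pderiv j (christoffel G k i k) x) +
    ∑ k, ∑ l, (christoffel G k k l x * christoffel G l i j x -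
      christoffel G k j l x * christoffel G l i k x)

/-! ### The totally symmetric trace-free part -/

/-- `T_{(a₁ … aₙ)}`. -/
def symmetrize {ι : Type} {n : ℕ} (T : Tensor ι ℂ n) : Tensor ι ℂ n :=
  fun I => (n.factorial : ℂ)⁻¹ * ∑ σ : Equiv.Perm (Fin n), T (I ∘ σ)

/-- `T` is totally symmetric. -/
def IsSymmetric {ι : Type} {n : ℕ} (T : Tensor ι ℂ n) : Prop :=
  ∀ (σ : Equiv.Perm (Fin n)) (I : Fin n → ι), T (I ∘ σ) = T I

/-- All traces of `T` with respect to the metric `h` vanish. -/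
def IsTraceFree {ι : Type} [Fintype ι] [DecidableEq ι] (h : Matrix ι ι ℝ) {n : ℕ}
    (T : Tensor ι ℂ n) : Prop :=
  ∀ a b : Fin n, a ≠ b → ∀ I : Fin n → ι,
    ∑ i, ∑ j, ((h⁻¹ i j : ℝ) : ℂ) * T (Function.update (Function.update I a i) b j) = 0

/-- The span of all tensors with a metric factor, `h_{c_a c_b} q`, where `q` carries the
other indices only. -/
def traceTerms {ι : Type} (h : Matrix ι ι ℝ) (n : ℕ) : Submodule ℂ (Tensor ι ℂ n) :=
  Submodule.span ℂ {B | ∃ a b : Fin n, a ≠ b ∧ ∃ q : Tensor ι ℂ n,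
    (∀ I J : Fin n → ι, (∀ k, k ≠ a → k ≠ b → I k = J k) → q I = q J) ∧
    B = fun I => ((h (I a) (I b) : ℝ) : ℂ) * q I}

/-- `S` is the totally symmetric and trace-free part of `T`: it is symmetric, trace-free, and
arises from the symmetrization of `T` by subtracting terms with a metric factor. -/
def IsSTFPart {ι : Type} [Fintype ι] [DecidableEq ι] (h : Matrix ι ι ℝ) {n : ℕ}
    (T S : Tensor ι ℂ n) : Prop :=
  IsSymmetric S ∧ IsTraceFree h S ∧ symmetrize T - S ∈ traceTerms h n

/-- `C[T]`, the totally symmetric and trace-free part of `T`. For a positive definite `h` exactly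
one tensor satisfies `IsSTFPart h T`. -/
def stfPart {ι : Type} [Fintype ι] [DecidableEq ι] (h : Matrix ι ι ℝ) {n : ℕ}
    (T : Tensor ι ℂ n) : Tensor ι ℂ n :=
  Classical.epsilon (IsSTFPart h T)

/-! ### The Geroch–Hansen tensors -/

/-- The tensors `P, P_{a₁}, P_{a₁a₂}, …` generated from the metric `G` and the potential `P = φ`:
`P_{a₁…aₙ} = C[D_{a₁} P_{a₂…aₙ} - ((n-1)(2n-3)/2) R_{a₁a₂} P_{a₃…aₙ}]`. For `n = 1` the
coefficient vanishes; the last clause is the case of rank `n + 2`. -/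
def multipoleTensor {ι : Type} [Fintype ι] [DecidableEq ι] (G : (ι → ℝ) → Matrix ι ι ℝ)
    (φ : (ι → ℝ) → ℂ) : (n : ℕ) → (ι → ℝ) → Tensor ι ℂ n
  | 0 => fun x _ => φ x
  | 1 => fun x => stfPart (G x) (covDeriv G (multipoleTensor G φ 0) x)
  | n + 2 => fun x => stfPart (G x) fun I =>
      covDeriv G (multipoleTensor G φ (n + 1)) x I -
        (((n : ℂ) + 1) * (2 * n + 1) / 2) * (ricci G x (I 0) (I 1) : ℂ) *
          multipoleTensor G φ n x (Fin.tail (Fin.tail I))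

/-! ### Stationary spacetimes -/

/-- `ℝ × V`, with the time coordinate at index `0`. -/
def spacetimeRegion (V : Set (Fin 3 → ℝ)) : Set (Fin 4 → ℝ) := {p | Fin.tail p ∈ V}

/-- The vector field `ξ = ∂/∂t`. -/
def xi : Fin 4 → ℝ := Pi.single 0 1

/-- The signature `(-,+,+,+)`. -/
def IsLorentzian (g : Matrix (Fin 4) (Fin 4) ℝ) : Prop :=
  ∃ B : Matrix (Fin 4) (Fin 4) ℝ, IsUnit B.det ∧
    B.transpose * g * B = Matrix.diagonal ![-1, 1, 1, 1]

/-- The volume form `ε_{abcd}` of `g` for the coordinate orientation. -/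
def volumeForm (g : Matrix (Fin 4) (Fin 4) ℝ) (a b c d : Fin 4) : ℝ :=
  √|g.det| * Matrix.det (Matrix.of fun i j : Fin 4 => if ![a, b, c, d] i = j then (1 : ℝ) else 0)

/-- The one-form `ε_{abcd} ξ^b ∇^c ξ^d` of the metric `g`. -/
def twistForm (g : (Fin 4 → ℝ) → Matrix (Fin 4) (Fin 4) ℝ) (p : Fin 4 → ℝ) (a : Fin 4) : ℝ :=
  ∑ b, ∑ c, ∑ d, volumeForm (g p) a b c d * xi b *
    ∑ c', ∑ d', (g p)⁻¹ c c' * (g p)⁻¹ d d' *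
      covDeriv (n := 1) g (fun q I => (g q).mulVec xi (I 0)) p ![c', d']

/-- A stationary spacetime whose manifold of Killing trajectories is the open set `V ⊆ ℝ³`, in
coordinates `(t, x) ∈ ℝ × V` adapted to the timelike Killing field `ξ = ∂/∂t`, together with its
twist potential `ω`, `∇_a ω = ε_{abcd} ξ^b ∇^c ξ^d`. -/
structure StationarySpacetime (V : Set (Fin 3 → ℝ)) where
  g : (Fin 4 → ℝ) → Matrix (Fin 4) (Fin 4) ℝ
  smooth : ∀ a b, ContDiffOn ℝ ∞ (fun p => g p a b) (spacetimeRegion V)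
  symm : ∀ p ∈ spacetimeRegion V, (g p).IsSymm
  lorentzian : ∀ p ∈ spacetimeRegion V, IsLorentzian (g p)
  stationary : ∀ p ∈ spacetimeRegion V, ∀ t : ℝ, g (p + t • xi) = g p
  timelike : ∀ p ∈ spacetimeRegion V, dotProduct xi ((g p).mulVec xi) < 0
  omega : (Fin 3 → ℝ) → ℝ
  omega_smooth : ContDiffOn ℝ ∞ omega V
  twist : ∀ p ∈ spacetimeRegion V, ∀ a,
    pderiv a (fun q => omega (Fin.tail q)) p = twistForm g p a

namespace StationarySpacetime

variable {V : Set (Fin 3 → ℝ)} (M : StationarySpacetime V)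

/-- The metric over the point `x ∈ V` (it does not depend on `t`). -/
def gAt (x : Fin 3 → ℝ) : Matrix (Fin 4) (Fin 4) ℝ := M.g (Fin.cons 0 x)

/-- `λ = -ξ^a ξ_a`. -/
def lam (x : Fin 3 → ℝ) : ℝ := -dotProduct xi ((M.gAt x).mulVec xi)

/-- The metric `h_{ab} = λ g_{ab} + ξ_a ξ_b` on the manifold of trajectories. -/
def h (x : Fin 3 → ℝ) : Matrix (Fin 3) (Fin 3) ℝ :=
  Matrix.of fun i j => M.lam x * M.gAt x i.succ j.succ +
    (M.gAt x).mulVec xi i.succ * (M.gAt x).mulVec xi j.succ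

/-- The potential `φ = φ_M + i φ_J`, `φ_M = (λ² + ω² - 1)/(4λ)`, `φ_J = ω/(2λ)`. -/
def potential (x : Fin 3 → ℝ) : ℂ :=
  (((M.lam x ^ 2 + M.omega x ^ 2 - 1) / (4 * M.lam x) : ℝ) : ℂ) +
    Complex.I * ((M.omega x / (2 * M.lam x) : ℝ) : ℂ)

end StationarySpacetime

/-- Asymptotic flatness: a conformal completion of `V = U \ {Λ}` by the single point `Λ = 0`, and
the rescaled potential `φ̃ = φ / √Ω`, which extends smoothly to `Λ`. -/
structure ConformalCompletion (U : Set (Fin 3 → ℝ)) (M : StationarySpacetime (U \ {0})) where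
  isOpen : IsOpen U
  mem_zero : (0 : Fin 3 → ℝ) ∈ U
  Ω : (Fin 3 → ℝ) → ℝ
  Ω_smooth : ContDiffOn ℝ ∞ Ω U
  Ω_pos : ∀ x ∈ U \ {0}, 0 < Ω x
  /-- the rescaled metric `h̃ = Ω² h` -/
  hT : (Fin 3 → ℝ) → Matrix (Fin 3) (Fin 3) ℝ
  hT_smooth : ∀ i j, ContDiffOn ℝ ∞ (fun x => hT x i j) U
  hT_posDef : ∀ x ∈ U, (hT x).PosDef
  hT_eq : ∀ x ∈ U \ {0}, hT x = Ω x ^ 2 • M.h x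
  Ω_zero : Ω 0 = 0
  dΩ_zero : ∀ a, covDeriv (n := 0) hT (fun x _ => Ω x) 0 ![a] = 0
  hessΩ_zero : ∀ a b,
    covDeriv hT (covDeriv (n := 0) hT (fun x _ => Ω x)) 0 ![a, b] = 2 * hT 0 a b
  /-- the rescaled potential -/
  phiT : (Fin 3 → ℝ) → ℂ
  phiT_smooth : ContDiffOn ℝ ∞ phiT U
  phiT_eq : ∀ x ∈ U \ {0}, phiT x = M.potential x / ((√(Ω x) : ℝ) : ℂ)

/-! ### Axisymmetry -/

/-- Rotation of space about the third (`z̃`) axis. -/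
def rot (α : ℝ) : Matrix (Fin 3) (Fin 3) ℝ :=
  !![Real.cos α, -Real.sin α, 0; Real.sin α, Real.cos α, 0; 0, 0, 1]

/-- The same rotation acting on spacetime. -/
def rotST (α : ℝ) : Matrix (Fin 4) (Fin 4) ℝ :=
  !![1, 0, 0, 0; 0, Real.cos α, -Real.sin α, 0; 0, Real.sin α, Real.cos α, 0; 0, 0, 0, 1]

/-- The distance `ρ̃` from the axis, for `x = (ρ̃ cos φ, ρ̃ sin φ, z̃)`. -/
def rho (x : Fin 3 → ℝ) : ℝ := √(x 0 ^ 2 + x 1 ^ 2)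

/-- The one-form `dρ̃` (off the axis). -/
def dRho (x : Fin 3 → ℝ) : Fin 3 → ℝ := ![x 0 / rho x, x 1 / rho x, 0]

/-- The one-form `dφ` (off the axis). -/
def dPhi (x : Fin 3 → ℝ) : Fin 3 → ℝ := ![-x 1 / rho x ^ 2, x 0 / rho x ^ 2, 0]

/-- The one-form `dz̃`. -/
def dZ : Fin 3 → ℝ := ![0, 0, 1]

/-- The spacetime is axisymmetric, and its rescaled metric is
`e^{2κ} (ρ̃² e^{-2β} dφ² + dρ̃² + dz̃²)` with axisymmetric smooth `κ`, `β` and `κ(Λ) = 0`. The form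
of the metric is required off the axis; on the axis it holds by continuity. -/
structure IsAxisymmetric {U : Set (Fin 3 → ℝ)} {M : StationarySpacetime (U \ {0})}
    (A : ConformalCompletion U M) (κ β : (Fin 3 → ℝ) → ℝ) : Prop where
  domain : ∀ α, ∀ x ∈ U, (rot α).mulVec x ∈ U
  metric : ∀ α, ∀ p ∈ spacetimeRegion (U \ {0}),
    (rotST α).transpose * M.g ((rotST α).mulVec p) * rotST α = M.g p
  omega : ∀ α, ∀ x ∈ U \ {0}, M.omega ((rot α).mulVec x) = M.omega x
  κ_smooth : ContDiffOn ℝ ∞ κ U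
  κ_inv : ∀ α, ∀ x ∈ U, κ ((rot α).mulVec x) = κ x
  κ_zero : κ 0 = 0
  β_smooth : ContDiffOn ℝ ∞ β U
  β_inv : ∀ α, ∀ x ∈ U, β ((rot α).mulVec x) = β x
  form : ∀ x ∈ U, rho x ≠ 0 → A.hT x = Real.exp (2 * κ x) •
    ((rho x ^ 2 * Real.exp (-2 * β x)) • Matrix.vecMulVec (dPhi x) (dPhi x) +
      Matrix.vecMulVec (dRho x) (dRho x) + Matrix.vecMulVec dZ dZ)

/-! ### The scalars -/

/-- The point of the meridian plane at angle `α` with coordinates `q = (z̃, ρ̃)`; as usual `ρ̃` may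
also be negative. -/
def meridian (α : ℝ) (q : ℝ × ℝ) : Fin 3 → ℝ := ![q.2 * Real.cos α, q.2 * Real.sin α, q.1]

/-- The part of the meridian plane at angle `α` that lies in `U`. -/
def meridianDomain (U : Set (Fin 3 → ℝ)) (α : ℝ) : Set (ℝ × ℝ) := {q | meridian α q ∈ U}

/-- Cartesian components of `η = ∂/∂z̃ - i ∂/∂ρ̃` along the meridian plane at angle `α`. -/
def eta (α : ℝ) : Fin 3 → ℂ := ![-Complex.I * Real.cos α, -Complex.I * Real.sin α, 1]

/-- `v^{a₁} ⋯ v^{aₙ} T_{a₁…aₙ}`. -/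
def contract (v : Fin 3 → ℂ) {n : ℕ} (T : Tensor (Fin 3) ℂ n) : ℂ :=
  ∑ I : Fin n → Fin 3, (∏ k, v (I k)) * T I

/-- `η^a D̃_a F = ∂F/∂z̃ - i ∂F/∂ρ̃` for a function `F` of `(z̃, ρ̃)`. -/
def etaD (F : ℝ × ℝ → ℂ) (q : ℝ × ℝ) : ℂ :=
  fderiv ℝ F q (1, 0) - Complex.I * fderiv ℝ F q (0, 1)

namespace ConformalCompletion

variable {U : Set (Fin 3 → ℝ)} {M : StationarySpacetime (U \ {0})} (A : ConformalCompletion U M)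

/-- The Geroch–Hansen tensors `P_{a₁…aₙ}` of the spacetime. -/
def P (n : ℕ) : (Fin 3 → ℝ) → Tensor (Fin 3) ℂ n := multipoleTensor A.hT A.phiT n

/-- `fₙ = η^{a₁} ⋯ η^{aₙ} P_{a₁…aₙ}` as a function of `(z̃, ρ̃)` on the meridian plane at angle
`α`. -/
def f (α : ℝ) (n : ℕ) (q : ℝ × ℝ) : ℂ := contract (eta α) (A.P n (meridian α q))

/-- `η^a η^b R̃_{ab}` on the meridian plane at angle `α`. -/
def etaRicci (α : ℝ) (q : ℝ × ℝ) : ℂ :=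
  contract (eta α) (n := 2) fun I => (ricci A.hT (meridian α q) (I 0) (I 1) : ℂ)

/-- `m` is the `n`-th multipole moment: `P_{a₁…aₙ}(Λ) = m C[z_{a₁} ⋯ z_{aₙ}]` with `z = dz̃`. -/
def IsMoment (n : ℕ) (m : ℂ) : Prop :=
  A.P n 0 = m • stfPart (A.hT 0) fun I : Fin n → Fin 3 => ∏ k, (dZ (I k) : ℂ)

end ConformalCompletion

end

end GerochHansen

open scoped ContDiff

namespace GerochHansen

/-! ### Sums over multi-indices -/

/-! On the meridian plane of angle `α` the rescaled metric is `e^{2κ} (1 + (e^{-2β} - 1) φ̂ ⊗ φ̂)`,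
where `φ̂` is the Euclidean unit vector in the direction of rotation. The vector `η` is orthogonal
to `φ̂` and null for the Euclidean metric, so it is null for `h̃` too. Contracting all slots with a
null vector sees neither symmetrization nor terms with a metric factor, hence `η⋯η C[T] = η⋯η T`
(`IsSTFPart.contract_eq`).

Moreover `η` is geodesic up to parametrization: `Γ^k_{ij} η^i η^j = 2 (η^a ∂_a κ) η^k`
(`IsAxisymmetric.sum_christoffel_eta`). In `η⋯η D̃T`, for `T` of rank `n`, each of the `n`
connection terms therefore returns the same multiple of `η⋯η T`, which gives `η^a D̃_a f_n - 2 n f_n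
η^a D̃_a κ` (`contract_covDeriv`). The Ricci term factors under contraction, and the recursion
`IsAxisymmetric.f_succ` follows.

Independence of the angle is an induction along the recursion: `φ̃` and `κ` are rotation invariant,
and `η^a η^b R̃_{ab}` does not depend on the angle because rotations are linear isometries of `h̃`
(`IsLinearIsometry.ricci_eq`).

All meridian planes meet at `Λ`, where `h̃` is Euclidean. So the one tensor `P_{a₁…aₙ}(Λ)` has the
same contraction `f_n(Λ)` with `η` for every angle, while `C[z⋯z]` has contraction `1` for every
angle. A symmetric trace-free tensor is determined by these contractions
(`eq_zero_of_contract_eta`), so the two are proportional with factor `f_n(Λ)`.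

Since `C` is defined by a choice, existence must be established before anything is known about it,
and smoothness of the `P`'s needs `C` to depend smoothly on the metric. A smooth orthonormal frame
settles both: it conjugates `C` to one fixed linear map, the Euclidean `C`. -/

/-- Exchanging `i` with the entry `I a` is an involution of the pairs `(I, i)`. This lets one slot
be summed first without splitting off that slot from the multi-index, at the price of the factor
`Fintype.card ι`. -/
lemma sum_sum_update {ι M : Type*} [Fintype ι] [AddCommMonoid M] {n : ℕ} (a : Fin n)
    (F : (Fin n → ι) → M) :
    ∑ I, ∑ i, F (Function.update I a i) = Fintype.card ι • ∑ I, F I := by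
  let e : ((Fin n → ι) × ι) ≃ ((Fin n → ι) × ι) :=
    { toFun := fun p => (Function.update p.1 a p.2, p.1 a)
      invFun := fun p => (Function.update p.1 a p.2, p.1 a)
      left_inv := fun p => by simp
      right_inv := fun p => by simp }
  rw [← Fintype.sum_prod_type' (f := fun I i => F (Function.update I a i)),
    Fintype.sum_equiv e (fun p => F (Function.update p.1 a p.2)) (fun p => F p.1) (fun p => rfl),
    Fintype.sum_prod_type]
  simp [Finset.smul_sum]

lemma sum_sum_update_update {ι M : Type*} [Fintype ι] [AddCommMonoid M] {n : ℕ} (a b : Fin n)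
    (F : (Fin n → ι) → M) :
    ∑ I, ∑ i, ∑ j, F (Function.update (Function.update I a i) b j) =
      (Fintype.card ι * Fintype.card ι) • ∑ I, F I := by
  rw [sum_sum_update a (fun I => ∑ j, F (Function.update I b j)), sum_sum_update, mul_smul]

lemma prod_update {ι : Type*} {n : ℕ} (g : Fin n → ι → ℂ) (I : Fin n → ι) (a : Fin n) (i : ι) :
    ∏ k, g k (Function.update I a i k) = g a i * ∏ k ∈ Finset.univ.erase a, g k (I k) := by
  rw [← Finset.mul_prod_erase _ _ (Finset.mem_univ a)]
  congr 1
  · simp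
  · refine Finset.prod_congr rfl fun k hk => ?_
    rw [Function.update_of_ne (Finset.ne_of_mem_erase hk)]

lemma prod_update_update {ι : Type*} {n : ℕ} (g : Fin n → ι → ℂ) (I : Fin n → ι) {a b : Fin n}
    (hab : a ≠ b) (i j : ι) :
    ∏ k, g k (Function.update (Function.update I a i) b j k) =
      g a i * g b j * ∏ k ∈ (Finset.univ.erase b).erase a, g k (I k) := by
  rw [prod_update, ← Finset.mul_prod_erase _ _ (Finset.mem_erase.2 ⟨hab, Finset.mem_univ a⟩)]
  rw [Function.update_self, ← mul_assoc, mul_comm (g b j)]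
  congr 1
  refine Finset.prod_congr rfl fun k hk => ?_
  rw [Function.update_of_ne (Finset.ne_of_mem_erase hk)]

/-! ### Pullback of tensors -/

/-- `(E^* T)_{i₁…iₙ} = E^{j₁}_{i₁} ⋯ E^{jₙ}_{iₙ} T_{j₁…jₙ}`. -/
noncomputable def pullback {ι : Type} [Fintype ι] (E : Matrix ι ι ℝ) {n : ℕ} (T : Tensor ι ℂ n) :
    Tensor ι ℂ n :=
  fun I => ∑ J : Fin n → ι, (∏ k, ((E (J k) (I k) : ℝ) : ℂ)) * T J

lemma pullback_mul {ι : Type} [Fintype ι] {n : ℕ} (E F : Matrix ι ι ℝ) (T : Tensor ι ℂ n) :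
    pullback (E * F) T = pullback F (pullback E T) := by
  funext I
  simp only [pullback, Finset.mul_sum]
  rw [Finset.sum_comm]
  refine Finset.sum_congr rfl fun K _ => ?_
  simp only [← mul_assoc]
  rw [← Finset.sum_mul]
  congr 1
  simp only [Matrix.mul_apply, Complex.ofReal_sum, Complex.ofReal_mul]
  rw [Finset.prod_univ_sum, Fintype.piFinset_univ]
  refine Finset.sum_congr rfl fun J _ => ?_
  rw [← Finset.prod_mul_distrib]
  exact Finset.prod_congr rfl fun k _ => mul_comm _ _

lemma pullback_one {ι : Type} [Fintype ι] [DecidableEq ι] {n : ℕ} (T : Tensor ι ℂ n) :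
    pullback (1 : Matrix ι ι ℝ) T = T := by
  funext I
  simp only [pullback]
  rw [Finset.sum_eq_single I]
  · simp
  · intro J _ hJ
    obtain ⟨k, hk⟩ := Function.ne_iff.1 hJ
    rw [Finset.prod_eq_zero (Finset.mem_univ k) (by simp [Matrix.one_apply_ne hk]), zero_mul]
  · simp

lemma pullback_sub {ι : Type} [Fintype ι] {n : ℕ} (E : Matrix ι ι ℝ) (S T : Tensor ι ℂ n) :
    pullback E (S - T) = pullback E S - pullback E T := by
  funext I
  simp [pullback, mul_sub]

/-! ### Naturality of the trace-free symmetric part -/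

lemma sum_comp_perm {ι M : Type*} [Fintype ι] [AddCommMonoid M] {n : ℕ} (σ : Equiv.Perm (Fin n))
    (F : (Fin n → ι) → M) : ∑ I : Fin n → ι, F (I ∘ σ) = ∑ I, F I :=
  Fintype.sum_equiv (Equiv.arrowCongr σ.symm (Equiv.refl ι)) _ _ fun I => by
    congr 1

lemma pullback_comp_perm {ι : Type} [Fintype ι] {n : ℕ} (E : Matrix ι ι ℝ) (T : Tensor ι ℂ n)
    (σ : Equiv.Perm (Fin n)) (I : Fin n → ι) :
    pullback E T (I ∘ σ) = pullback E (fun J => T (J ∘ σ)) I := by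
  simp only [pullback]
  rw [← sum_comp_perm σ]
  refine Finset.sum_congr rfl fun J _ => ?_
  rw [← Equiv.prod_comp σ (fun k => ((E (J k) (I k) : ℝ) : ℂ))]
  rfl

lemma pullback_symmetrize {ι : Type} [Fintype ι] {n : ℕ} (E : Matrix ι ι ℝ) (T : Tensor ι ℂ n) :
    pullback E (symmetrize T) = symmetrize (pullback E T) := by
  funext I
  simp only [symmetrize, pullback_comp_perm]
  simp only [pullback, symmetrize, Finset.mul_sum]
  rw [Finset.sum_comm]
  refine Finset.sum_congr rfl fun J _ => Finset.sum_congr rfl fun σ _ => ?_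
  ring

lemma IsSymmetric.pullback {ι : Type} [Fintype ι] {n : ℕ} {T : Tensor ι ℂ n} (hT : IsSymmetric T)
    (E : Matrix ι ι ℝ) : IsSymmetric (pullback E T) := by
  intro σ I
  rw [pullback_comp_perm]
  congr 1
  funext J
  exact hT σ J

lemma sum_eq_zero_of_sum_update_update {ι : Type*} [Fintype ι] {n : ℕ} {a b : Fin n}
    {F : (Fin n → ι) → ℂ}
    (h : ∀ I, ∑ i, ∑ j, F (Function.update (Function.update I a i) b j) = 0) : ∑ I, F I = 0 := by
  rcases isEmpty_or_nonempty ι with hι | hι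
  · refine Finset.sum_eq_zero fun I _ => ?_
    exact hι.elim (I a)
  · have := sum_sum_update_update a b F
    simp only [h, Finset.sum_const_zero] at this
    have hc : Fintype.card ι ≠ 0 := Fintype.card_ne_zero
    have := this.symm
    rw [nsmul_eq_mul, mul_eq_zero] at this
    rcases this with h0 | h0
    · simp [hc] at h0
    · exact h0

/-- With `h' = Eᵀ h E` one has `E h'⁻¹ Eᵀ = h⁻¹`, so an `h'`-trace of the pullback is a combination
of `h`-traces of `T`. -/
lemma IsTraceFree.pullback {ι : Type} [Fintype ι] [DecidableEq ι] {n : ℕ} {h E : Matrix ι ι ℝ}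
    (hE : IsUnit E.det) {T : Tensor ι ℂ n} (hT : IsTraceFree h T) :
    IsTraceFree (E.transpose * h * E) (pullback E T) := by
  intro a b hab I
  have hinv : ∀ c d, ∑ i, ∑ j, (E.transpose * h * E)⁻¹ i j * (E c i * E d j) = h⁻¹ c d := by
    intro c d
    have : E * (E.transpose * h * E)⁻¹ * E.transpose = h⁻¹ := by
      rw [Matrix.mul_inv_rev, Matrix.mul_inv_rev, ← mul_assoc, Matrix.mul_nonsing_inv _ hE, one_mul,
        mul_assoc, Matrix.nonsing_inv_mul _ (by rwa [Matrix.det_transpose]), mul_one]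
    rw [← this]
    simp only [Matrix.mul_apply, Matrix.transpose_apply, Finset.sum_mul]
    rw [Finset.sum_comm]
    exact Finset.sum_congr rfl fun i _ => Finset.sum_congr rfl fun j _ => by ring
  simp only [GerochHansen.pullback]
  have key : ∀ (i j : ι) (J : Fin n → ι),
      ∏ k, ((E (J k) (Function.update (Function.update I a i) b j k) : ℝ) : ℂ) =
      (E (J a) i : ℂ) * (E (J b) j : ℂ) *
        ∏ k ∈ (Finset.univ.erase b).erase a, ((E (J k) (I k) : ℝ) : ℂ) := fun i j J =>
    prod_update_update (fun k m => ((E (J k) m : ℝ) : ℂ)) I hab i j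
  simp only [key]
  calc _ = ∑ J : Fin n → ι, ((h⁻¹ (J a) (J b) : ℝ) : ℂ) *
        (∏ k ∈ (Finset.univ.erase b).erase a, ((E (J k) (I k) : ℝ) : ℂ)) * T J := by
        simp only [← hinv, Complex.ofReal_sum, Finset.sum_mul, Finset.mul_sum]
        rw [Finset.sum_comm]
        conv_rhs => rw [Finset.sum_comm]
        rw [Finset.sum_comm]
        refine Finset.sum_congr rfl fun i _ => ?_
        rw [Finset.sum_comm]
        refine Finset.sum_congr rfl fun J _ => Finset.sum_congr rfl fun j _ => ?_
        push_cast
        ring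
    _ = 0 := by
        refine sum_eq_zero_of_sum_update_update (a := a) (b := b) fun J => ?_
        have hJ := hT a b hab J
        rw [← mul_eq_zero_of_right (∏ k ∈ (Finset.univ.erase b).erase a, ((E (J k) (I k) : ℝ) : ℂ)) hJ,
          Finset.mul_sum]
        refine Finset.sum_congr rfl fun i _ => ?_
        rw [Finset.mul_sum]
        refine Finset.sum_congr rfl fun j _ => ?_
        rw [Function.update_self, Function.update_of_ne hab, Function.update_self]
        have : ∏ k ∈ (Finset.univ.erase b).erase a,
            ((E (Function.update (Function.update J a i) b j k) (I k) : ℝ) : ℂ) =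
            ∏ k ∈ (Finset.univ.erase b).erase a, ((E (J k) (I k) : ℝ) : ℂ) := by
          refine Finset.prod_congr rfl fun k hk => ?_
          rw [Function.update_of_ne (Finset.ne_of_mem_erase (Finset.mem_of_mem_erase hk)),
            Function.update_of_ne (Finset.ne_of_mem_erase hk)]
        rw [this]
        ring

lemma pullback_mem_traceTerms {ι : Type} [Fintype ι] {n : ℕ} (h E : Matrix ι ι ℝ)
    {T : Tensor ι ℂ n} (hT : T ∈ traceTerms h n) :
    pullback E T ∈ traceTerms (E.transpose * h * E) n := by
  induction hT using Submodule.span_induction with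
  | zero =>
    have : pullback E (0 : Tensor ι ℂ n) = 0 := by funext I; simp [pullback]
    rw [this]
    exact Submodule.zero_mem _
  | add S T _ _ hS hT =>
    have : pullback E (S + T) = pullback E S + pullback E T := by
      funext I; simp [pullback, mul_add, Finset.sum_add_distrib]
    rw [this]
    exact Submodule.add_mem _ hS hT
  | smul c T _ hT =>
    have : pullback E (c • T) = c • pullback E T := by
      funext I
      simp only [pullback, Pi.smul_apply, smul_eq_mul, Finset.mul_sum]
      exact Finset.sum_congr rfl fun J _ => by ring
    rw [this]
    exact Submodule.smul_mem _ _ hT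
  | mem T hT =>
    obtain ⟨a, b, hab, q, hq, rfl⟩ := hT
    -- The new cofactor is `q` pulled back in the slots other than `a` and `b`. The sum still runs
    -- over all of `J`, so the entries `J a`, `J b`, on which nothing depends, are divided out by
    -- the inverse square of the cardinality.
    refine Submodule.subset_span ⟨a, b, hab, fun I =>
      ((Fintype.card ι * Fintype.card ι : ℕ) : ℂ)⁻¹ * ∑ J : Fin n → ι,
        (∏ k ∈ (Finset.univ.erase b).erase a, ((E (J k) (I k) : ℝ) : ℂ)) * q J, ?_, ?_⟩
    · intro I I' hI
      dsimp only
      congr 1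
      refine Finset.sum_congr rfl fun J _ => ?_
      congr 1
      refine Finset.prod_congr rfl fun k hk => ?_
      rw [hI k (Finset.ne_of_mem_erase hk) (Finset.ne_of_mem_erase (Finset.mem_of_mem_erase hk))]
    · funext I
      have hc : ((Fintype.card ι * Fintype.card ι : ℕ) : ℂ) ≠ 0 := by
        have : Nonempty ι := ⟨I a⟩
        simp
      simp only [pullback]
      refine mul_left_cancel₀ hc ?_
      rw [← nsmul_eq_mul, ← sum_sum_update_update a b]
      rw [mul_left_comm, mul_inv_cancel_left₀ hc, Finset.mul_sum]
      refine Finset.sum_congr rfl fun J _ => ?_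
      rw [Matrix.mul_apply, Complex.ofReal_sum]
      simp only [Matrix.mul_apply, Matrix.transpose_apply, Complex.ofReal_mul, Complex.ofReal_sum,
        Finset.sum_mul]
      rw [Finset.sum_comm]
      refine Finset.sum_congr rfl fun i _ => Finset.sum_congr rfl fun j _ => ?_
      rw [prod_update_update (fun k m => ((E m (I k) : ℝ) : ℂ)) J hab]
      have : q (Function.update (Function.update J a j) b i) = q J := by
        refine hq _ _ fun k hka hkb => ?_
        rw [Function.update_of_ne hkb, Function.update_of_ne hka]
      rw [this, Function.update_self, Function.update_of_ne hab, Function.update_self]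
      ring

lemma IsSTFPart.pullback {ι : Type} [Fintype ι] [DecidableEq ι] {n : ℕ} {h E : Matrix ι ι ℝ}
    (hE : IsUnit E.det) {T S : Tensor ι ℂ n} (hS : IsSTFPart h T S) :
    IsSTFPart (E.transpose * h * E) (pullback E T) (pullback E S) := by
  refine ⟨hS.1.pullback E, hS.2.1.pullback hE, ?_⟩
  rw [← pullback_symmetrize, ← pullback_sub]
  exact pullback_mem_traceTerms h E hS.2.2

/-! ### Contractions -/

section Contract

variable {n : ℕ} (v : Fin 3 → ℂ)

lemma contract_add (S T : Tensor (Fin 3) ℂ n) :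
    contract v (S + T) = contract v S + contract v T := by
  simp [contract, mul_add, Finset.sum_add_distrib]

lemma contract_sub (S T : Tensor (Fin 3) ℂ n) :
    contract v (S - T) = contract v S - contract v T := by
  simp [contract, mul_sub]

lemma contract_smul (c : ℂ) (T : Tensor (Fin 3) ℂ n) : contract v (c • T) = c * contract v T := by
  simp only [contract, Pi.smul_apply, smul_eq_mul, Finset.mul_sum]
  exact Finset.sum_congr rfl fun J _ => by ring

lemma contract_zero : contract v (0 : Tensor (Fin 3) ℂ n) = 0 := by
  simp [contract]

lemma contract_symmetrize (T : Tensor (Fin 3) ℂ n) : contract v (symmetrize T) = contract v T := by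
  simp only [contract, symmetrize]
  have h : ∀ σ : Equiv.Perm (Fin n), ∑ I : Fin n → Fin 3, (∏ k, v (I k)) * T (I ∘ σ) =
      ∑ I : Fin n → Fin 3, (∏ k, v (I k)) * T I := by
    intro σ
    rw [← sum_comp_perm σ (fun I => (∏ k, v (I k)) * T I)]
    refine Finset.sum_congr rfl fun I _ => ?_
    rw [← Equiv.prod_comp σ (fun k => v (I k))]
    rfl
  have hf : (n.factorial : ℂ) ≠ 0 := by exact_mod_cast n.factorial_ne_zero
  calc _ = (n.factorial : ℂ)⁻¹ * ∑ σ : Equiv.Perm (Fin n),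
        ∑ I : Fin n → Fin 3, (∏ k, v (I k)) * T (I ∘ σ) := by
        rw [Finset.sum_comm]
        simp only [Finset.mul_sum]
        exact Finset.sum_congr rfl fun I _ => Finset.sum_congr rfl fun σ _ => by ring
    _ = _ := by
        simp only [h, Finset.sum_const, Finset.card_univ, Fintype.card_perm, Fintype.card_fin,
          nsmul_eq_mul]
        rw [inv_mul_cancel_left₀ hf]

/-- Summing over the slots `a` and `b` first produces the factor `h(v, v) = 0`. -/
lemma contract_traceTerms {h : Matrix (Fin 3) (Fin 3) ℝ}
    (hv : ∑ i, ∑ j, ((h i j : ℝ) : ℂ) * (v i * v j) = 0) {T : Tensor (Fin 3) ℂ n}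
    (hT : T ∈ traceTerms h n) : contract v T = 0 := by
  induction hT using Submodule.span_induction with
  | zero => exact contract_zero v
  | add S T _ _ hS hT => rw [contract_add, hS, hT, add_zero]
  | smul c T _ hT => rw [contract_smul, hT, mul_zero]
  | mem T hT =>
    obtain ⟨a, b, hab, q, hq, rfl⟩ := hT
    refine sum_eq_zero_of_sum_update_update (a := a) (b := b) fun I => ?_
    rw [← mul_eq_zero_of_right ((∏ k ∈ (Finset.univ.erase b).erase a, v (I k)) * q I) hv,
      Finset.mul_sum]
    refine Finset.sum_congr rfl fun i _ => ?_
    rw [Finset.mul_sum]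
    refine Finset.sum_congr rfl fun j _ => ?_
    rw [prod_update_update (fun _ m => v m) I hab]
    dsimp only
    have : q (Function.update (Function.update I a i) b j) = q I := by
      refine hq _ _ fun k hka hkb => ?_
      rw [Function.update_of_ne hkb, Function.update_of_ne hka]
    rw [this, Function.update_self, Function.update_of_ne hab, Function.update_self]
    ring

lemma IsSTFPart.contract_eq {h : Matrix (Fin 3) (Fin 3) ℝ}
    (hv : ∑ i, ∑ j, ((h i j : ℝ) : ℂ) * (v i * v j) = 0) {T S : Tensor (Fin 3) ℂ n}
    (hS : IsSTFPart h T S) : contract v S = contract v T := by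
  have := contract_traceTerms v hv hS.2.2
  rw [contract_sub, contract_symmetrize, sub_eq_zero] at this
  exact this.symm

end Contract

/-! ### Symmetric trace-free tensors are determined by their contractions with null vectors -/

/-- Insertion of a vector into the first slot, `v^a T_{a a₁ … aₙ}`. -/
noncomputable def insertFirst {n : ℕ} (v : Fin 3 → ℂ) (T : Tensor (Fin 3) ℂ (n + 1)) :
    Tensor (Fin 3) ℂ n :=
  fun I => ∑ i, v i * T (Fin.cons i I)

/-- The components of `T` with first index `i`. -/
def slice {n : ℕ} (i : Fin 3) (T : Tensor (Fin 3) ℂ (n + 1)) : Tensor (Fin 3) ℂ n :=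
  fun I => T (Fin.cons i I)

lemma insertFirst_eq_sum {n : ℕ} (v : Fin 3 → ℂ) (T : Tensor (Fin 3) ℂ (n + 1)) :
    insertFirst v T = ∑ i, v i • slice i T := by
  funext I
  simp [insertFirst, slice]

lemma contract_sum {n : ℕ} (v : Fin 3 → ℂ) {κ : Type*} (s : Finset κ)
    (T : κ → Tensor (Fin 3) ℂ n) : contract v (∑ i ∈ s, T i) = ∑ i ∈ s, contract v (T i) := by
  simp only [contract, Finset.sum_apply, Finset.mul_sum]
  rw [Finset.sum_comm]

lemma contract_insertFirst {n : ℕ} (v w : Fin 3 → ℂ) (T : Tensor (Fin 3) ℂ (n + 1)) :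
    contract v (insertFirst w T) = ∑ i, w i * contract v (slice i T) := by
  rw [insertFirst_eq_sum, contract_sum]
  simp only [contract_smul]

lemma contract_succ {n : ℕ} (v : Fin 3 → ℂ) (T : Tensor (Fin 3) ℂ (n + 1)) :
    contract v T = ∑ i, v i * contract v (slice i T) := by
  simp only [contract, Finset.mul_sum, slice]
  rw [← Fintype.sum_prod_type']
  refine (Fintype.sum_equiv (Fin.consEquiv (fun _ => Fin 3)) _ _ fun p => ?_).symm
  change _ = (∏ k, v ((Fin.cons p.1 p.2 : Fin (n + 1) → Fin 3) k)) * T (Fin.cons p.1 p.2)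
  rw [Fin.prod_univ_succ]
  simp only [Fin.cons_zero, Fin.cons_succ]
  ring

lemma IsSymmetric.slice {n : ℕ} {T : Tensor (Fin 3) ℂ (n + 1)} (hT : IsSymmetric T) (i : Fin 3) :
    IsSymmetric (slice i T) := by
  intro σ I
  -- This permutation fixes `0` and acts as `σ` on the remaining slots.
  have h := hT (Equiv.Perm.decomposeFin.symm (0, σ)) (Fin.cons i I)
  rw [GerochHansen.slice, GerochHansen.slice, ← h]
  congr 1
  funext k
  refine Fin.cases ?_ (fun k => ?_) k
  · simp
  · simp

lemma IsSymmetric.slice_slice {n : ℕ} {T : Tensor (Fin 3) ℂ (n + 2)} (hT : IsSymmetric T)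
    (i j : Fin 3) : GerochHansen.slice i (GerochHansen.slice j T) =
      GerochHansen.slice j (GerochHansen.slice i T) := by
  funext I
  have h := hT (Equiv.swap 0 1) (Fin.cons j (Fin.cons i I))
  simp only [GerochHansen.slice]
  rw [← h]
  congr 1
  funext k
  refine Fin.cases ?_ (fun k => ?_) k
  · simp
  · refine Fin.cases ?_ (fun k => ?_) k
    · simp
    · simp only [Function.comp_apply]
      rw [Equiv.swap_apply_of_ne_of_ne (Fin.succ_ne_zero _)
        (by rw [← Fin.succ_zero_eq_one]; exact fun h => Fin.succ_ne_zero _ (Fin.succ_injective _ h))]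
      simp

lemma IsTraceFree.slice {n : ℕ} {h : Matrix (Fin 3) (Fin 3) ℝ} {T : Tensor (Fin 3) ℂ (n + 1)}
    (hT : IsTraceFree h T) (i : Fin 3) : IsTraceFree h (slice i T) := by
  intro a b hab I
  have := hT a.succ b.succ (fun h => hab (Fin.succ_injective _ h)) (Fin.cons i I)
  simp only [← Fin.cons_update] at this
  exact this

lemma IsTraceFree.sum_slice_slice {n : ℕ} {T : Tensor (Fin 3) ℂ (n + 2)}
    (hT : IsTraceFree (1 : Matrix (Fin 3) (Fin 3) ℝ) T) :
    ∑ i, GerochHansen.slice i (GerochHansen.slice i T) = 0 := by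
  funext I
  have h := hT 1 0 one_ne_zero (Fin.cons 0 (Fin.cons 0 I))
  have hu : ∀ i j : Fin 3, Function.update (Function.update
      (Fin.cons 0 (Fin.cons 0 I) : Fin (n + 2) → Fin 3) 1 i) 0 j = Fin.cons j (Fin.cons i I) := by
    intro i j
    rw [← Fin.succ_zero_eq_one, ← Fin.cons_update, Fin.update_cons_zero, Fin.update_cons_zero]
  simp only [hu, inv_one, Matrix.one_apply] at h
  rw [Finset.sum_apply]
  simpa [GerochHansen.slice, apply_ite Complex.ofReal] using h

/-- The product rule gives one term per slot, and symmetry of `T` makes the `n + 1` terms equal. -/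
lemma hasDerivAt_contract {n : ℕ} {T : Tensor (Fin 3) ℂ (n + 1)} (hT : IsSymmetric T)
    {v : ℝ → Fin 3 → ℂ} {v' : Fin 3 → ℂ} {t : ℝ} (hv : ∀ i, HasDerivAt (fun s => v s i) (v' i) t) :
    HasDerivAt (fun s => contract (v s) T) ((n + 1) * contract (v t) (insertFirst v' T)) t := by
  induction n with
  | zero =>
    have h0 : ∀ (w : Fin 3 → ℂ) (S : Tensor (Fin 3) ℂ 0), contract w S = S Fin.elim0 := by
      intro w S
      simp only [contract, Finset.univ_unique, Finset.sum_singleton, Finset.univ_eq_empty,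
        Finset.prod_empty, one_mul]
      congr 1
    simp only [contract_succ, h0]
    simp only [Nat.cast_zero, zero_add, one_mul]
    exact HasDerivAt.fun_sum fun i _ => (hv i).mul_const _
  | succ n ih =>
    have h1 : HasDerivAt (fun s => contract (v s) T)
        (∑ i, (v' i * contract (v t) (slice i T) +
          v t i * ((n + 1) * contract (v t) (insertFirst v' (slice i T))))) t := by
      simp only [contract_succ (n := n + 1)]
      exact HasDerivAt.fun_sum fun i _ => (hv i).mul (ih (hT.slice i))
    convert h1 using 1
    have h2 : ∀ i, insertFirst v' (slice i T) = slice i (insertFirst v' T) := by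
      intro i
      funext I
      have : ∀ j, slice i T (Fin.cons j I) = T (Fin.cons j (Fin.cons i I)) := fun j =>
        congrFun (hT.slice_slice j i) I
      simp only [insertFirst, this]
      rfl
    simp only [h2]
    rw [Finset.sum_add_distrib, ← contract_insertFirst]
    have h3 : ∑ i, v t i * (((n : ℂ) + 1) * contract (v t) (slice i (insertFirst v' T))) =
        (n + 1) * contract (v t) (insertFirst v' T) := by
      rw [contract_succ (v t) (insertFirst v' T), Finset.mul_sum]
      exact Finset.sum_congr rfl fun i _ => by ring
    rw [h3]
    push_cast
    ring

/-- The derivative of `eta` with respect to the angle. -/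
noncomputable def etaDeriv (α : ℝ) : Fin 3 → ℂ :=
  ![Complex.I * Real.sin α, -Complex.I * Real.cos α, 0]

lemma hasDerivAt_eta (α : ℝ) (i : Fin 3) : HasDerivAt (fun s => eta s i) (etaDeriv α i) α := by
  have hc : HasDerivAt (fun s : ℝ => ((Real.cos s : ℝ) : ℂ)) ((-Real.sin α : ℝ) : ℂ) α :=
    (Real.hasDerivAt_cos α).ofReal_comp
  have hs : HasDerivAt (fun s : ℝ => ((Real.sin s : ℝ) : ℂ)) ((Real.cos α : ℝ) : ℂ) α :=
    (Real.hasDerivAt_sin α).ofReal_comp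
  fin_cases i
  · have := hc.const_mul (-Complex.I)
    simpa [eta, etaDeriv] using this
  · have := hs.const_mul (-Complex.I)
    simpa [eta, etaDeriv] using this
  · simpa [eta, etaDeriv] using hasDerivAt_const α (1 : ℂ)

lemma hasDerivAt_etaDeriv (α : ℝ) (i : Fin 3) :
    HasDerivAt (fun s => etaDeriv s i) ((Pi.single 2 1 - eta α : Fin 3 → ℂ) i) α := by
  have hc : HasDerivAt (fun s : ℝ => ((Real.cos s : ℝ) : ℂ)) ((-Real.sin α : ℝ) : ℂ) α :=
    (Real.hasDerivAt_cos α).ofReal_comp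
  have hs : HasDerivAt (fun s : ℝ => ((Real.sin s : ℝ) : ℂ)) ((Real.cos α : ℝ) : ℂ) α :=
    (Real.hasDerivAt_sin α).ofReal_comp
  fin_cases i
  · have := hs.const_mul Complex.I
    simpa [eta, etaDeriv] using this
  · have := hc.const_mul (-Complex.I)
    simpa [eta, etaDeriv] using this
  · simpa [eta, etaDeriv] using hasDerivAt_const α (0 : ℂ)

/-- With `r̂` the radial unit vector, `η = z - i r̂` and `η' = -i φ̂`; the formula is the
completeness relation `z ⊗ z + r̂ ⊗ r̂ + φ̂ ⊗ φ̂ = 1` with `r̂` and `φ̂` eliminated. -/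
lemma etaDeriv_mul_etaDeriv (α : ℝ) (i j : Fin 3) :
    etaDeriv α i * etaDeriv α j = -(if i = j then 1 else 0) - eta α i * eta α j +
      eta α i * (Pi.single 2 1 : Fin 3 → ℂ) j + (Pi.single 2 1 : Fin 3 → ℂ) i * eta α j := by
  have h : (Complex.sin α) ^ 2 + (Complex.cos α) ^ 2 = 1 := Complex.sin_sq_add_cos_sq _
  have hI := Complex.I_sq
  fin_cases i <;> fin_cases j <;> simp [eta, etaDeriv]
  · linear_combination (Complex.sin α ^ 2 + Complex.cos α ^ 2) * hI - h
  · ring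
  · ring
  · linear_combination (Complex.sin α ^ 2 + Complex.cos α ^ 2) * hI - h

/-- Induction on the rank. Differentiating `η⋯η D = 0` in the angle once makes the contraction with
one `η'` and otherwise `η` vanish. Differentiating again brings in `η'' = z - η` and `η' ⊗ η'`; the
completeness relation and the vanishing trace reduce everything to a nonzero multiple of the
contraction with one `z`. Since `η`, `η'`, `z` span `ℂ³`, every slice of `D` has vanishing
contractions with all `η`, hence is zero by induction. -/
theorem eq_zero_of_contract_eta {n : ℕ} {D : Tensor (Fin 3) ℂ n} (hD : IsSymmetric D)
    (hD' : IsTraceFree (1 : Matrix (Fin 3) (Fin 3) ℝ) D) (h : ∀ α, contract (eta α) D = 0) :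
    D = 0 := by
  induction n with
  | zero =>
    funext I
    have := h 0
    simp only [contract, Finset.univ_unique, Finset.sum_singleton, Finset.univ_eq_empty,
        Finset.prod_empty, one_mul] at this
    rw [Pi.zero_apply, ← this]
    congr 1
    exact Subsingleton.elim _ _
  | succ n ih =>
    have h1 : ∀ α, contract (eta α) (insertFirst (etaDeriv α) D) = 0 := by
      intro α
      have hd := hasDerivAt_contract hD (hasDerivAt_eta α)
      simp only [h] at hd
      have := hd.unique (hasDerivAt_const α (0 : ℂ))
      exact (mul_eq_zero.1 this).resolve_left (by exact_mod_cast n.succ_ne_zero)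
    have h2 : ∀ α, contract (eta α) (slice 2 D) = 0 := by
      intro α
      have h0 : HasDerivAt (fun s => ∑ i, etaDeriv s i * contract (eta s) (slice i D)) 0 α := by
        simp only [← contract_insertFirst, h1]
        exact hasDerivAt_const α (0 : ℂ)
      have hz : ∑ i, (Pi.single 2 1 - eta α : Fin 3 → ℂ) i * contract (eta α) (slice i D) =
          contract (eta α) (slice 2 D) := by
        simp only [Pi.sub_apply, sub_mul, Finset.sum_sub_distrib, ← contract_succ, h, sub_zero]
        simp [Pi.single_apply]
      cases n with
      | zero =>
        have hc : ∀ (w w' : Fin 3 → ℂ) (S : Tensor (Fin 3) ℂ 0), contract w S = contract w' S := by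
          intro w w' S
          simp [contract]
        have h3 : HasDerivAt (fun s => ∑ i, etaDeriv s i * contract (eta s) (slice i D))
            (∑ i, (Pi.single 2 1 - eta α : Fin 3 → ℂ) i * contract (eta α) (slice i D)) α := by
          simp only [fun s => hc (eta s) (eta α)]
          exact HasDerivAt.fun_sum fun i _ => (hasDerivAt_etaDeriv α i).mul_const _
        rw [← hz]
        exact h3.unique h0
      | succ m =>
        have h3 : HasDerivAt (fun s => ∑ i, etaDeriv s i * contract (eta s) (slice i D))
            (∑ i, ((Pi.single 2 1 - eta α : Fin 3 → ℂ) i * contract (eta α) (slice i D) +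
              etaDeriv α i *
                ((m + 1) * contract (eta α) (insertFirst (etaDeriv α) (slice i D))))) α :=
          HasDerivAt.fun_sum fun i _ => (hasDerivAt_etaDeriv α i).mul
            (hasDerivAt_contract (hD.slice i) (hasDerivAt_eta α))
        have h4 := h3.unique h0
        rw [Finset.sum_add_distrib, hz] at h4
        simp only [contract_insertFirst, Finset.mul_sum] at h4
        have ht : ∑ i, contract (eta α) (slice i (slice i D)) = 0 := by
          rw [← contract_sum, hD'.sum_slice_slice, contract_zero]
        have h5 : ∑ i, ∑ j, etaDeriv α i * etaDeriv α j * contract (eta α) (slice j (slice i D)) =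
            2 * contract (eta α) (slice 2 D) := by
          simp only [etaDeriv_mul_etaDeriv, add_mul, sub_mul, Finset.sum_add_distrib,
            Finset.sum_sub_distrib]
          have e1 : ∑ i, ∑ j, -(if i = j then (1 : ℂ) else 0) *
              contract (eta α) (slice j (slice i D)) = 0 := by
            simpa using ht
          have e2 : ∑ i, ∑ j, eta α i * eta α j * contract (eta α) (slice j (slice i D)) = 0 := by
            rw [← h α, contract_succ]
            refine Finset.sum_congr rfl fun i _ => ?_
            rw [contract_succ, Finset.mul_sum]
            exact Finset.sum_congr rfl fun j _ => by ring
          have e3 : ∑ i, ∑ j, (Pi.single 2 1 : Fin 3 → ℂ) i * eta α j *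
              contract (eta α) (slice j (slice i D)) = contract (eta α) (slice 2 D) := by
            rw [contract_succ]
            simp [Pi.single_apply, ite_mul]
          have e4 : ∑ i, ∑ j, eta α i * (Pi.single 2 1 : Fin 3 → ℂ) j *
              contract (eta α) (slice j (slice i D)) = contract (eta α) (slice 2 D) := by
            rw [← e3, Finset.sum_comm]
            refine Finset.sum_congr rfl fun i _ => Finset.sum_congr rfl fun j _ => ?_
            rw [hD.slice_slice]
            ring
          rw [e1, e2, e3, e4]
          ring
        have h6 : ∑ i, ∑ j, etaDeriv α i * ((m + 1) * (etaDeriv α j *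
            contract (eta α) (slice j (slice i D)))) = (m + 1) * (2 * contract (eta α) (slice 2 D)) := by
          rw [← h5]
          simp only [Finset.mul_sum]
          exact Finset.sum_congr rfl fun i _ => Finset.sum_congr rfl fun j _ => by ring
        rw [h6] at h4
        -- The coefficient is `1` from `η'' = z - η` plus `2 (m + 1)` from the `m + 1` slots in
        -- which a second `η'` can appear.
        have h7 : ((2 * m + 3 : ℕ) : ℂ) * contract (eta α) (slice 2 D) = 0 := by
          rw [← h4]
          push_cast
          ring
        exact (mul_eq_zero.1 h7).resolve_left (Nat.cast_ne_zero.2 (by omega))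
    have h8 : ∀ i, slice i D = 0 := by
      intro i
      refine ih (hD.slice i) (hD'.slice i) fun α => ?_
      have hcs : (Complex.sin α) ^ 2 + (Complex.cos α) ^ 2 = 1 := Complex.sin_sq_add_cos_sq _
      have ha := h α
      have hb := h1 α
      have hc := h2 α
      have hI := Complex.I_sq
      rw [contract_succ] at ha
      rw [contract_insertFirst] at hb
      simp only [Fin.sum_univ_three] at ha hb
      simp only [eta, etaDeriv, Matrix.cons_val_zero, Matrix.cons_val_one, Matrix.cons_val,
        Complex.ofReal_cos, Complex.ofReal_sin] at ha hb
      -- The combinations below express `e_x = i cos α (η - z) - i sin α η'` and `e_y = i sin α (η -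
      -- z) + i cos α η'`.
      fin_cases i
      · change contract (eta α) (slice 0 D) = 0
        simp only [eta, Complex.ofReal_cos, Complex.ofReal_sin] at hc ⊢
        linear_combination Complex.I * Complex.cos α * ha - Complex.I * Complex.sin α * hb
          - Complex.I * Complex.cos α * hc
          - (contract _ (slice 0 D)) * hcs + (Complex.sin α ^2 + Complex.cos α ^ 2) *
            (contract _ (slice 0 D)) * hI
      · change contract (eta α) (slice 1 D) = 0
        simp only [eta, Complex.ofReal_cos, Complex.ofReal_sin] at hc ⊢
        linear_combination Complex.I * Complex.sin α * ha + Complex.I * Complex.cos α * hb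
          - Complex.I * Complex.sin α * hc
          - (contract _ (slice 1 D)) * hcs + (Complex.sin α ^2 + Complex.cos α ^ 2) *
            (contract _ (slice 1 D)) * hI
      · exact hc
    funext I
    rw [← Fin.cons_self_tail I]
    exact congrFun (h8 (I 0)) (Fin.tail I)

/-! ### Existence and uniqueness of the symmetric trace-free part -/

lemma isSymmetric_symmetrize {ι : Type} {n : ℕ} (T : Tensor ι ℂ n) :
    IsSymmetric (symmetrize T) := by
  intro σ I
  simp only [symmetrize]
  congr 1
  exact Fintype.sum_equiv (Equiv.mulLeft σ) _ _ fun τ => rfl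

lemma update_update_comp_perm {ι : Type*} {n : ℕ} (σ : Equiv.Perm (Fin n)) (I : Fin n → ι)
    (a b : Fin n) (i j : ι) :
    Function.update (Function.update I a i) b j ∘ σ =
      Function.update (Function.update (I ∘ σ) (σ.symm a) i) (σ.symm b) j := by
  rw [Function.update_comp_equiv, Function.update_comp_equiv]

lemma IsTraceFree.symmetrize {ι : Type} [Fintype ι] [DecidableEq ι] {h : Matrix ι ι ℝ} {n : ℕ}
    {T : Tensor ι ℂ n} (hT : IsTraceFree h T) : IsTraceFree h (symmetrize T) := by
  intro a b hab I
  simp only [GerochHansen.symmetrize, update_update_comp_perm]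
  have h0 : ∀ σ : Equiv.Perm (Fin n), ∑ i, ∑ j, ((h⁻¹ i j : ℝ) : ℂ) *
      T (Function.update (Function.update (I ∘ σ) (σ.symm a) i) (σ.symm b) j) = 0 := fun σ =>
    hT _ _ (fun h => hab (σ.symm.injective h)) _
  calc _ = (n.factorial : ℂ)⁻¹ * ∑ σ : Equiv.Perm (Fin n), ∑ i, ∑ j, ((h⁻¹ i j : ℝ) : ℂ) *
      T (Function.update (Function.update (I ∘ σ) (σ.symm a) i) (σ.symm b) j) := by
        simp only [Finset.mul_sum]
        conv_rhs => rw [Finset.sum_comm]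
        refine Finset.sum_congr rfl fun i _ => ?_
        conv_rhs => rw [Finset.sum_comm]
        refine Finset.sum_congr rfl fun j _ => Finset.sum_congr rfl fun σ _ => ?_
        ring
    _ = 0 := by simp [h0]

lemma symmetrize_mem_traceTerms {ι : Type} {h : Matrix ι ι ℝ} {n : ℕ}
    {T : Tensor ι ℂ n} (hT : T ∈ traceTerms h n) : symmetrize T ∈ traceTerms h n := by
  have h1 : ∀ σ : Equiv.Perm (Fin n), (fun I => T (I ∘ σ)) ∈ traceTerms h n := by
    intro σ
    induction hT using Submodule.span_induction with
    | zero => exact Submodule.zero_mem _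
    | add S T _ _ hS hT => exact Submodule.add_mem _ hS hT
    | smul c T _ hT => exact Submodule.smul_mem _ c hT
    | mem T hT =>
      obtain ⟨a, b, hab, q, hq, rfl⟩ := hT
      refine Submodule.subset_span ⟨σ a, σ b, fun h => hab (σ.injective h), fun I => q (I ∘ σ),
        fun I J hIJ => hq _ _ fun k hka hkb => ?_, rfl⟩
      exact hIJ _ (fun h => hka (σ.injective h)) (fun h => hkb (σ.injective h))
  have h2 : symmetrize T = (n.factorial : ℂ)⁻¹ • ∑ σ : Equiv.Perm (Fin n), fun I => T (I ∘ σ) := by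
    funext I
    simp [symmetrize]
  rw [h2]
  exact Submodule.smul_mem _ _ (Submodule.sum_mem _ fun σ _ => h1 σ)

lemma symmetrize_sub {ι : Type} {n : ℕ} (S T : Tensor ι ℂ n) :
    symmetrize (S - T) = symmetrize S - symmetrize T := by
  funext I
  simp [symmetrize, mul_sub]

lemma symmetrize_add {ι : Type} {n : ℕ} (S T : Tensor ι ℂ n) :
    symmetrize (S + T) = symmetrize S + symmetrize T := by
  funext I
  simp [symmetrize, mul_add, Finset.sum_add_distrib]

lemma symmetrize_smul {ι : Type} {n : ℕ} (c : ℂ) (T : Tensor ι ℂ n) :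
    symmetrize (c • T) = c • symmetrize T := by
  funext I
  simp only [symmetrize, Pi.smul_apply, smul_eq_mul, Finset.mul_sum]
  exact Finset.sum_congr rfl fun J _ => by ring

/-- For the Hermitian inner product on components, being orthogonal to all trace terms is the same
as having vanishing Euclidean traces, so `B` is the orthogonal projection of `T` onto the trace
terms. -/
lemma exists_mem_traceTerms_isTraceFree_sub {ι : Type} [Fintype ι] [DecidableEq ι] {n : ℕ}
    (T : Tensor ι ℂ n) :
    ∃ B ∈ traceTerms (1 : Matrix ι ι ℝ) n, IsTraceFree (1 : Matrix ι ι ℝ) (T - B) := by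
  classical
  let e := WithLp.linearEquiv 2 ℂ (Tensor ι ℂ n)
  let W : Submodule ℂ (EuclideanSpace ℂ (Fin n → ι)) := (traceTerms (1 : Matrix ι ι ℝ) n).comap
    e.toLinearMap
  obtain ⟨y, hy, z, hz, hT⟩ := W.exists_add_mem_mem_orthogonal (e.symm T)
  refine ⟨e y, hy, ?_⟩
  have hz' : T - e y = e z := by
    rw [sub_eq_iff_eq_add', ← map_add, ← hT, LinearEquiv.apply_symm_apply]
  rw [hz']
  intro a b hab I
  -- With `q` the indicator of agreeing with `I` outside `a` and `b`, the inner product with `δ_{ab}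
  -- q` is exactly the `(a, b)` trace at `I`.
  set q : Tensor ι ℂ n := fun J => if ∀ k, k ≠ a → k ≠ b → J k = I k then 1 else 0 with hq
  have hB : (fun J => (((1 : Matrix ι ι ℝ) (J a) (J b) : ℝ) : ℂ) * q J) ∈
      traceTerms (1 : Matrix ι ι ℝ) n := by
    refine Submodule.subset_span ⟨a, b, hab, q, fun J J' hJ => ?_, rfl⟩
    have : (∀ k, k ≠ a → k ≠ b → J k = I k) ↔ (∀ k, k ≠ a → k ≠ b → J' k = I k) :=
      forall_congr' fun k => forall_congr' fun ha => forall_congr' fun hb => by rw [hJ k ha hb]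
    simp only [hq, this]
  have horth := hz (e.symm fun J => (((1 : Matrix ι ι ℝ) (J a) (J b) : ℝ) : ℂ) * q J)
    (by simpa [W] using hB)
  rw [PiLp.inner_apply] at horth
  have horth' : ∑ J : Fin n → ι, (((1 : Matrix ι ι ℝ) (J a) (J b) : ℝ) : ℂ) * q J * e z J = 0 := by
    rw [← horth]
    refine Finset.sum_congr rfl fun J _ => ?_
    have hr : (starRingEnd ℂ) (q J) = q J := by
      simp only [hq]
      split_ifs <;> simp
    change _ = e z J * (starRingEnd ℂ) ((((1 : Matrix ι ι ℝ) (J a) (J b) : ℝ) : ℂ) * q J)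
    rw [map_mul, Complex.conj_ofReal, hr]
    ring
  have hsum := sum_sum_update_update a b
    (fun J => (((1 : Matrix ι ι ℝ) (J a) (J b) : ℝ) : ℂ) * q J * e z J)
  rw [horth', smul_zero] at hsum
  have hterm : ∀ J : Fin n → ι, ∑ i, ∑ j, (((1 : Matrix ι ι ℝ)
        (Function.update (Function.update J a i) b j a)
        (Function.update (Function.update J a i) b j b) : ℝ) : ℂ) *
        q (Function.update (Function.update J a i) b j) *
        e z (Function.update (Function.update J a i) b j) =
      q J * ∑ i, ∑ j, (((1 : Matrix ι ι ℝ)⁻¹ i j : ℝ) : ℂ) *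
        e z (Function.update (Function.update I a i) b j) := by
    intro J
    simp only [Finset.mul_sum]
    refine Finset.sum_congr rfl fun i _ => Finset.sum_congr rfl fun j _ => ?_
    rw [Function.update_self, Function.update_of_ne hab, Function.update_self, inv_one]
    have hqJ : q (Function.update (Function.update J a i) b j) = q J := by
      have : (∀ k, k ≠ a → k ≠ b → Function.update (Function.update J a i) b j k = I k) ↔
          (∀ k, k ≠ a → k ≠ b → J k = I k) :=
        forall_congr' fun k => forall_congr' fun ha => forall_congr' fun hb => by
          rw [Function.update_of_ne hb, Function.update_of_ne ha]
      simp only [hq, this]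
    rw [hqJ]
    by_cases hJ : ∀ k, k ≠ a → k ≠ b → J k = I k
    · have : Function.update (Function.update J a i) b j =
          Function.update (Function.update I a i) b j := by
        funext k
        by_cases hb : k = b
        · subst hb; simp
        · rw [Function.update_of_ne hb, Function.update_of_ne hb]
          by_cases ha : k = a
          · subst ha; simp
          · rw [Function.update_of_ne ha, Function.update_of_ne ha, hJ k ha hb]
      rw [this]
      ring
    · have : q J = 0 := if_neg hJ
      rw [this]
      ring
  simp only [hterm] at hsum
  rw [← Finset.sum_mul] at hsum
  refine (mul_eq_zero.1 hsum).resolve_left ?_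
  rw [hq, Finset.sum_boole]
  exact Nat.cast_ne_zero.2 (Finset.card_ne_zero.2 ⟨I, by simp⟩)

lemma exists_isSTFPart_one {ι : Type} [Fintype ι] [DecidableEq ι] {n : ℕ} (T : Tensor ι ℂ n) :
    ∃ S, IsSTFPart (1 : Matrix ι ι ℝ) T S := by
  obtain ⟨B, hB, hTB⟩ := exists_mem_traceTerms_isTraceFree_sub T
  refine ⟨symmetrize (T - B), isSymmetric_symmetrize _, hTB.symmetrize, ?_⟩
  rw [symmetrize_sub, sub_sub_cancel]
  exact symmetrize_mem_traceTerms hB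

lemma eta_null (α : ℝ) :
    ∑ i, ∑ j, (((1 : Matrix (Fin 3) (Fin 3) ℝ) i j : ℝ) : ℂ) * (eta α i * eta α j) = 0 := by
  have h : (Complex.sin α) ^ 2 + (Complex.cos α) ^ 2 = 1 := Complex.sin_sq_add_cos_sq _
  simp [Fin.sum_univ_three, eta, Matrix.one_apply]
  linear_combination (Complex.sin α ^ 2 + Complex.cos α ^ 2) * Complex.I_sq - h

lemma IsSymmetric.sub {ι : Type} {n : ℕ} {S T : Tensor ι ℂ n} (hS : IsSymmetric S)
    (hT : IsSymmetric T) : IsSymmetric (S - T) := fun σ I => by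
  rw [Pi.sub_apply, Pi.sub_apply, hS, hT]

lemma IsTraceFree.sub {ι : Type} [Fintype ι] [DecidableEq ι] {h : Matrix ι ι ℝ} {n : ℕ}
    {S T : Tensor ι ℂ n} (hS : IsTraceFree h S) (hT : IsTraceFree h T) : IsTraceFree h (S - T) := by
  intro a b hab I
  simp only [Pi.sub_apply, mul_sub, Finset.sum_sub_distrib, hS a b hab I, hT a b hab I, sub_zero]

lemma IsSymmetric.smul {ι : Type} {n : ℕ} {T : Tensor ι ℂ n} (hT : IsSymmetric T) (c : ℂ) :
    IsSymmetric (c • T) := fun σ I => by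
  rw [Pi.smul_apply, Pi.smul_apply, hT]

lemma IsTraceFree.smul {ι : Type} [Fintype ι] [DecidableEq ι] {h : Matrix ι ι ℝ} {n : ℕ}
    {T : Tensor ι ℂ n} (hT : IsTraceFree h T) (c : ℂ) : IsTraceFree h (c • T) := by
  intro a b hab I
  simp only [Pi.smul_apply, smul_eq_mul, mul_left_comm _ c, ← Finset.mul_sum, hT a b hab I,
    mul_zero]

/-- Both candidates have the same contraction with every `η` as `T` itself, so their difference
vanishes. -/
lemma IsSTFPart.unique_one {n : ℕ} {T S S' : Tensor (Fin 3) ℂ n} (hS : IsSTFPart 1 T S)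
    (hS' : IsSTFPart 1 T S') : S = S' := by
  refine sub_eq_zero.1 (eq_zero_of_contract_eta (hS.1.sub hS'.1) (hS.2.1.sub hS'.2.1) fun α => ?_)
  rw [contract_sub, hS.contract_eq _ (eta_null α), hS'.contract_eq _ (eta_null α), sub_self]

/-! ### Orthonormal frames: reduction of a general metric to the Euclidean one -/

/-- A matrix `E` with `h = Eᵀ E` is an orthonormal frame for `h`. -/
structure IsFrame (h E : Matrix (Fin 3) (Fin 3) ℝ) : Prop where
  isUnit : IsUnit E.det
  eq : h = E.transpose * E

lemma IsFrame.isSTFPart_iff {n : ℕ} {h E : Matrix (Fin 3) (Fin 3) ℝ} (hE : IsFrame h E)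
    {T S : Tensor (Fin 3) ℂ n} :
    IsSTFPart h T S ↔ IsSTFPart 1 (pullback E⁻¹ T) (pullback E⁻¹ S) := by
  constructor
  · intro hS
    have := hS.pullback (Matrix.isUnit_nonsing_inv_det E hE.isUnit)
    rwa [hE.eq, ← mul_assoc, mul_assoc, Matrix.mul_nonsing_inv _ hE.isUnit, mul_one,
      ← Matrix.transpose_mul, Matrix.mul_nonsing_inv _ hE.isUnit, Matrix.transpose_one] at this
  · intro hS
    have := hS.pullback hE.isUnit
    rwa [← pullback_mul, ← pullback_mul, Matrix.nonsing_inv_mul _ hE.isUnit, pullback_one,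
      pullback_one, mul_one, ← hE.eq] at this

lemma stfPart_one_spec {n : ℕ} (T : Tensor (Fin 3) ℂ n) : IsSTFPart 1 T (stfPart 1 T) :=
  Classical.epsilon_spec (exists_isSTFPart_one T)

lemma IsFrame.isSTFPart_pullback {n : ℕ} {h E : Matrix (Fin 3) (Fin 3) ℝ} (hE : IsFrame h E)
    (T : Tensor (Fin 3) ℂ n) : IsSTFPart h T (pullback E (stfPart 1 (pullback E⁻¹ T))) := by
  rw [hE.isSTFPart_iff, ← pullback_mul, Matrix.mul_nonsing_inv _ hE.isUnit, pullback_one]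
  exact stfPart_one_spec _

lemma IsFrame.stfPart_spec {n : ℕ} {h E : Matrix (Fin 3) (Fin 3) ℝ} (hE : IsFrame h E)
    (T : Tensor (Fin 3) ℂ n) : IsSTFPart h T (stfPart h T) :=
  Classical.epsilon_spec ⟨_, hE.isSTFPart_pullback T⟩

lemma IsFrame.stfPart_eq {n : ℕ} {h E : Matrix (Fin 3) (Fin 3) ℝ} (hE : IsFrame h E)
    (T : Tensor (Fin 3) ℂ n) : stfPart h T = pullback E (stfPart 1 (pullback E⁻¹ T)) := by
  have h1 := hE.isSTFPart_iff.1 (hE.stfPart_spec T)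
  rw [h1.unique_one (stfPart_one_spec _) |>.symm, ← pullback_mul,
    Matrix.nonsing_inv_mul _ hE.isUnit, pullback_one]

/-- The symmetric trace-free part for the Euclidean metric, as a linear map. -/
noncomputable def stfPartOne (n : ℕ) : Tensor (Fin 3) ℂ n →ₗ[ℂ] Tensor (Fin 3) ℂ n where
  toFun := stfPart 1
  map_add' S T := by
    have hS := stfPart_one_spec S
    have hT := stfPart_one_spec T
    refine (stfPart_one_spec (S + T)).unique_one ⟨fun σ I => ?_, fun a b hab I => ?_, ?_⟩
    · rw [Pi.add_apply, Pi.add_apply, hS.1, hT.1]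
    · simp only [Pi.add_apply, mul_add, Finset.sum_add_distrib, hS.2.1 a b hab I,
        hT.2.1 a b hab I, add_zero]
    · rw [symmetrize_add, add_sub_add_comm]
      exact Submodule.add_mem _ hS.2.2 hT.2.2
  map_smul' c T := by
    have hT := stfPart_one_spec T
    refine (stfPart_one_spec (c • T)).unique_one ⟨hT.1.smul c, hT.2.1.smul c, ?_⟩
    rw [symmetrize_smul, RingHom.id_apply, ← smul_sub]
    exact Submodule.smul_mem _ _ hT.2.2

/-! ### Smoothness of the tensor calculus -/

section Smooth

variable {ι F : Type} [Fintype ι] [DecidableEq ι] [NormedAddCommGroup F] [NormedSpace ℝ F]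
  {U : Set (ι → ℝ)}

lemma contDiffOn_pderiv (hU : IsOpen U) {f : (ι → ℝ) → F} (hf : ContDiffOn ℝ ∞ f U) (i : ι) :
    ContDiffOn ℝ ∞ (pderiv i f) U :=
  (hf.fderiv_of_isOpen hU (m := ∞) (by simp)).clm_apply contDiffOn_const

lemma contDiffOn_det {E : Type*} [NormedAddCommGroup E] [NormedSpace ℝ E] {U : Set E}
    {A : E → Matrix ι ι ℝ} (hA : ∀ i j, ContDiffOn ℝ ∞ (fun x => A x i j) U) :
    ContDiffOn ℝ ∞ (fun x => (A x).det) U := by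
  simp only [Matrix.det_apply]
  refine ContDiffOn.sum fun σ _ => ContDiffOn.const_smul _ ?_
  exact contDiffOn_prod fun i _ => hA _ _

/-- Cramer's rule writes each entry of the inverse as a quotient of determinants. -/
lemma contDiffOn_inv_apply {E : Type*} [NormedAddCommGroup E] [NormedSpace ℝ E] {U : Set E}
    {A : E → Matrix ι ι ℝ} (hA : ∀ i j, ContDiffOn ℝ ∞ (fun x => A x i j) U)
    (hdet : ∀ x ∈ U, (A x).det ≠ 0) (i j : ι) : ContDiffOn ℝ ∞ (fun x => (A x)⁻¹ i j) U := by
  have : (fun x => (A x)⁻¹ i j) =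
      fun x => (A x).det⁻¹ * ((A x).updateRow j (Pi.single i 1)).det := by
    funext x
    rw [Matrix.inv_def, Matrix.smul_apply, Ring.inverse_eq_inv', Matrix.adjugate_apply, smul_eq_mul]
  rw [this]
  refine ((contDiffOn_det hA).inv hdet).mul (contDiffOn_det fun k l => ?_)
  by_cases hk : k = j
  · subst hk
    simpa using contDiffOn_const
  · simpa [Matrix.updateRow_ne hk] using hA k l

variable {G : (ι → ℝ) → Matrix ι ι ℝ}

lemma contDiffOn_christoffel (hU : IsOpen U) (hG : ∀ i j, ContDiffOn ℝ ∞ (fun x => G x i j) U)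
    (hdet : ∀ x ∈ U, (G x).det ≠ 0) (k i j : ι) : ContDiffOn ℝ ∞ (christoffel G k i j) U := by
  refine ContDiffOn.mul contDiffOn_const (ContDiffOn.sum fun l _ => ?_)
  exact (contDiffOn_inv_apply hG hdet k l).mul
    (((contDiffOn_pderiv hU (hG l j) i).add (contDiffOn_pderiv hU (hG l i) j)).sub
      (contDiffOn_pderiv hU (hG i j) l))

lemma contDiffOn_ricci (hU : IsOpen U) (hG : ∀ i j, ContDiffOn ℝ ∞ (fun x => G x i j) U)
    (hdet : ∀ x ∈ U, (G x).det ≠ 0) (i j : ι) : ContDiffOn ℝ ∞ (fun x => ricci G x i j) U := by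
  have hΓ := contDiffOn_christoffel hU hG hdet
  refine ContDiffOn.add (ContDiffOn.sum fun k _ => ?_)
    (ContDiffOn.sum fun k _ => ContDiffOn.sum fun l _ => ?_)
  · exact (contDiffOn_pderiv hU (hΓ k i j) k).sub (contDiffOn_pderiv hU (hΓ k i k) j)
  · exact ((hΓ k k l).mul (hΓ l i j)).sub ((hΓ k j l).mul (hΓ l i k))

lemma contDiffOn_covDeriv (hU : IsOpen U) (hG : ∀ i j, ContDiffOn ℝ ∞ (fun x => G x i j) U)
    (hdet : ∀ x ∈ U, (G x).det ≠ 0) {n : ℕ} {T : (ι → ℝ) → Tensor ι F n}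
    (hT : ∀ I, ContDiffOn ℝ ∞ (fun x => T x I) U) (I : Fin (n + 1) → ι) :
    ContDiffOn ℝ ∞ (fun x => covDeriv G T x I) U := by
  refine ContDiffOn.sub (contDiffOn_pderiv hU (hT _) _)
    (ContDiffOn.sum fun k _ => ContDiffOn.sum fun j _ => ?_)
  exact (contDiffOn_christoffel hU hG hdet _ _ _).smul (hT _)

end Smooth

lemma contDiffOn_pullback {ι : Type} [Fintype ι] {U : Set (ι → ℝ)} {E : (ι → ℝ) → Matrix ι ι ℝ}
    (hE : ∀ i j, ContDiffOn ℝ ∞ (fun x => E x i j) U) {n : ℕ} {T : (ι → ℝ) → Tensor ι ℂ n}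
    (hT : ∀ I, ContDiffOn ℝ ∞ (fun x => T x I) U) (I : Fin n → ι) :
    ContDiffOn ℝ ∞ (fun x => pullback (E x) (T x) I) U := by
  refine ContDiffOn.sum fun J _ => ContDiffOn.mul ?_ (hT J)
  exact contDiffOn_prod fun k _ => Complex.ofRealCLM.contDiff.comp_contDiffOn (hE _ _)

/-- `E` is a smooth field of orthonormal frames for the metric `G` on `U`. -/
structure IsSmoothFrame (U : Set (Fin 3 → ℝ)) (G E : (Fin 3 → ℝ) → Matrix (Fin 3) (Fin 3) ℝ) :
    Prop where
  isFrame : ∀ x ∈ U, IsFrame (G x) (E x)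
  smooth : ∀ i j, ContDiffOn ℝ ∞ (fun x => E x i j) U

section Frame

variable {U : Set (Fin 3 → ℝ)} {G E : (Fin 3 → ℝ) → Matrix (Fin 3) (Fin 3) ℝ}

/-- In a frame, `C` is pullback by `E⁻¹`, then the constant linear map `stfPartOne`, then pullback
by `E`; only the outer two vary with the point, and they do so smoothly. -/
lemma IsSmoothFrame.contDiffOn_stfPart (hE : IsSmoothFrame U G E) {n : ℕ}
    {T : (Fin 3 → ℝ) → Tensor (Fin 3) ℂ n} (hT : ∀ I, ContDiffOn ℝ ∞ (fun x => T x I) U)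
    (I : Fin n → Fin 3) : ContDiffOn ℝ ∞ (fun x => stfPart (G x) (T x) I) U := by
  have h1 : ∀ I, ContDiffOn ℝ ∞ (fun x => pullback (E x)⁻¹ (T x) I) U :=
    contDiffOn_pullback (fun i j => contDiffOn_inv_apply hE.smooth
      (fun x hx => (hE.isFrame x hx).isUnit.ne_zero) i j) hT
  have h2 : ∀ I, ContDiffOn ℝ ∞ (fun x => stfPartOne n (pullback (E x)⁻¹ (T x)) I) U := by
    refine contDiffOn_pi.1 ?_
    let L := LinearMap.toContinuousLinearMap ((stfPartOne n).restrictScalars ℝ)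
    exact L.contDiff.comp_contDiffOn (contDiffOn_pi.2 h1)
  refine (contDiffOn_pullback hE.smooth h2 I).congr fun x hx => ?_
  rw [(hE.isFrame x hx).stfPart_eq]
  rfl

lemma IsSmoothFrame.contDiffOn_metric (hE : IsSmoothFrame U G E) (i j : Fin 3) :
    ContDiffOn ℝ ∞ (fun x => G x i j) U := by
  refine ContDiffOn.congr (f := fun x => ∑ k, E x k i * E x k j)
    (ContDiffOn.sum fun k _ => (hE.smooth k i).mul (hE.smooth k j)) fun x hx => ?_
  rw [(hE.isFrame x hx).eq, Matrix.mul_apply]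
  rfl

lemma IsFrame.det_ne_zero {h E : Matrix (Fin 3) (Fin 3) ℝ} (hE : IsFrame h E) : h.det ≠ 0 := by
  rw [hE.eq, Matrix.det_mul, Matrix.det_transpose]
  exact mul_ne_zero hE.isUnit.ne_zero hE.isUnit.ne_zero

lemma IsSmoothFrame.contDiffOn_multipoleTensor (hE : IsSmoothFrame U G E) (hU : IsOpen U)
    {φ : (Fin 3 → ℝ) → ℂ} (hφ : ContDiffOn ℝ ∞ φ U) (n : ℕ) :
    ∀ I, ContDiffOn ℝ ∞ (fun x => multipoleTensor G φ n x I) U := by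
  have hdet : ∀ x ∈ U, (G x).det ≠ 0 := fun x hx => (hE.isFrame x hx).det_ne_zero
  induction n using Nat.twoStepInduction with
  | zero => exact fun I => hφ
  | one =>
    simp only [multipoleTensor]
    exact hE.contDiffOn_stfPart (contDiffOn_covDeriv hU hE.contDiffOn_metric hdet fun I => hφ)
  | more n h0 h1 =>
    simp only [multipoleTensor]
    refine hE.contDiffOn_stfPart fun I => ?_
    refine (contDiffOn_covDeriv hU hE.contDiffOn_metric hdet h1 I).sub ?_
    refine ContDiffOn.mul (contDiffOn_const.mul ?_) (h0 _)
    exact Complex.ofRealCLM.contDiff.comp_contDiffOn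
      (contDiffOn_ricci hU hE.contDiffOn_metric hdet _ _)

end Frame

/-! ### Contraction of the covariant derivative -/

/-- `v` is an eigenvector of `A`, so letting `A` act on slot `k` only multiplies the full
contraction by the eigenvalue. -/
lemma contract_replace {n : ℕ} {v : Fin 3 → ℂ} {A : Fin 3 → Fin 3 → ℂ} {c : ℂ}
    (hA : ∀ j, ∑ i, A j i * v i = c * v j) (T : Tensor (Fin 3) ℂ n) (k : Fin n) :
    ∑ I : Fin n → Fin 3, (∏ l, v (I l)) * ∑ j, A j (I k) * T (Function.update I k j) =
      c * contract v T := by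
  have h3 : ((Fintype.card (Fin 3) : ℕ) : ℂ) ≠ 0 := by simp
  refine mul_left_cancel₀ h3 ?_
  rw [← nsmul_eq_mul, ← sum_sum_update k, mul_left_comm, contract, ← nsmul_eq_mul,
    ← sum_sum_update k, Finset.mul_sum]
  refine Finset.sum_congr rfl fun I _ => ?_
  simp only [prod_update (fun _ m => v m), Function.update_self, Function.update_idem,
    Finset.mul_sum]
  rw [Finset.sum_comm]
  refine Finset.sum_congr rfl fun j _ => ?_
  calc _ = (∑ i, A j i * v i) * ((∏ l ∈ Finset.univ.erase k, v (I l)) *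
        T (Function.update I k j)) := by
        rw [Finset.sum_mul]
        exact Finset.sum_congr rfl fun i _ => by ring
    _ = _ := by
        rw [hA]
        ring

/-- The vector `v` has constant components, so it passes through the partial derivatives. The
hypothesis says that `v` is an eigenvector of `Γ^j_{im} v^i`, so each of the `n` connection terms
contributes `c` times the contraction. -/
lemma contract_covDeriv {G : (Fin 3 → ℝ) → Matrix (Fin 3) (Fin 3) ℝ} {n : ℕ}
    {T : (Fin 3 → ℝ) → Tensor (Fin 3) ℂ n} {x : Fin 3 → ℝ}
    (hT : ∀ I, DifferentiableAt ℝ (fun y => T y I) x) {v : Fin 3 → ℂ} {c : ℂ}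
    (hΓ : ∀ k, ∑ i, ∑ j, (christoffel G k i j x : ℂ) * (v i * v j) = c * v k) :
    contract v (covDeriv G T x) =
      ∑ i, v i * pderiv i (fun y => contract v (T y)) x - n * c * contract v (T x) := by
  have h1 : ∀ i, contract v (fun I => pderiv i (fun y => T y I) x) =
      pderiv i (fun y => contract v (T y)) x := by
    intro i
    simp only [contract, pderiv]
    rw [fderiv_fun_sum fun I _ => (hT I).const_mul _, sum_apply]
    refine Finset.sum_congr rfl fun I _ => ?_
    rw [fderiv_const_mul (hT I)]
    rfl
  have h2 : ∀ i, slice i (covDeriv G T x) = (fun I => pderiv i (fun y => T y I) x) -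
      ∑ k : Fin n, fun I => ∑ j, (christoffel G j i (I k) x : ℂ) * T x (Function.update I k j) := by
    intro i
    funext I
    simp [slice, covDeriv, Finset.sum_apply]
  rw [contract_succ]
  simp only [h2, contract_sub, contract_sum, h1, mul_sub, Finset.sum_sub_distrib]
  congr 1
  simp only [Finset.mul_sum]
  rw [Finset.sum_comm]
  have h3 : ∀ k : Fin n, ∑ i, v i * contract v (fun I => ∑ j, (christoffel G j i (I k) x : ℂ) *
      T x (Function.update I k j)) = c * contract v (T x) := by
    intro k
    rw [← contract_replace (A := fun j m => ∑ i, (christoffel G j i m x : ℂ) * v i) ?_ (T x) k]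
    · simp only [contract, Finset.mul_sum, Finset.sum_mul]
      rw [Finset.sum_comm]
      refine Finset.sum_congr rfl fun I _ => ?_
      rw [Finset.sum_comm]
      refine Finset.sum_congr rfl fun j _ => Finset.sum_congr rfl fun i _ => ?_
      ring
    · intro j
      rw [← hΓ j]
      simp only [Finset.sum_mul]
      rw [Finset.sum_comm]
      refine Finset.sum_congr rfl fun i _ => Finset.sum_congr rfl fun m _ => ?_
      ring
  rw [Finset.sum_congr rfl fun k _ => h3 k]
  simp
  ring

/-! ### Meridian planes -/

lemma contDiff_meridian (α : ℝ) : ContDiff ℝ ∞ (meridian α) := by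
  refine contDiff_pi.2 fun i => ?_
  fin_cases i
  · exact contDiff_snd.mul contDiff_const
  · exact contDiff_snd.mul contDiff_const
  · exact contDiff_fst

lemma isOpen_meridianDomain {U : Set (Fin 3 → ℝ)} (hU : IsOpen U) (α : ℝ) :
    IsOpen (meridianDomain U α) :=
  hU.preimage (contDiff_meridian α).continuous

lemma mapsTo_meridian (U : Set (Fin 3 → ℝ)) (α : ℝ) :
    Set.MapsTo (meridian α) (meridianDomain U α) U := fun _ hq => hq

lemma exists_eq_meridian (x : Fin 3 → ℝ) : ∃ α q, x = meridian α q := by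
  let w : ℂ := ⟨x 0, x 1⟩
  refine ⟨w.arg, (x 2, ‖w‖), ?_⟩
  funext i
  fin_cases i
  · exact (Complex.norm_mul_cos_arg w).symm
  · exact (Complex.norm_mul_sin_arg w).symm
  · rfl

/-- Continuous functions on a meridian plane that agree off the axis agree on the axis. -/
lemma eqOn_meridianDomain {X : Type*} [TopologicalSpace X] [T2Space X] {U : Set (Fin 3 → ℝ)}
    (hU : IsOpen U) {α : ℝ} {F H : ℝ × ℝ → X} (hF : ContinuousOn F (meridianDomain U α))
    (hH : ContinuousOn H (meridianDomain U α))
    (h : ∀ q ∈ meridianDomain U α, q.2 ≠ 0 → F q = H q) : Set.EqOn F H (meridianDomain U α) := by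
  have hd : Dense {q : ℝ × ℝ | q.2 ≠ 0} :=
    (dense_compl_singleton (0 : ℝ)).preimage isOpenMap_snd
  exact Set.EqOn.of_subset_closure (s := meridianDomain U α ∩ {q | q.2 ≠ 0})
    (fun q hq => h q hq.1 hq.2) hF hH Set.inter_subset_left
    (hd.open_subset_closure_inter (isOpen_meridianDomain hU α))

/-- The unit vector in the direction of the rotation, on the meridian plane at angle `α`. -/
noncomputable def phiHat (α : ℝ) : Fin 3 → ℝ := ![-Real.sin α, Real.cos α, 0]

lemma phiHat_mul_self (α : ℝ) : Matrix.vecMulVec (phiHat α) (phiHat α) *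
    Matrix.vecMulVec (phiHat α) (phiHat α) = Matrix.vecMulVec (phiHat α) (phiHat α) := by
  have h : phiHat α ⬝ᵥ phiHat α = 1 := by
    simp only [phiHat, dotProduct, Fin.sum_univ_three, Matrix.cons_val_zero, Matrix.cons_val_one,
      Matrix.cons_val]
    linear_combination Real.sin_sq_add_cos_sq α
  rw [Matrix.vecMulVec_mul_vecMulVec, h, one_smul]

lemma phiHat_eta (α : ℝ) : ∑ i, (phiHat α i : ℂ) * eta α i = 0 := by
  simp [phiHat, eta, Fin.sum_univ_three]
  ring

/-- The coordinate components of `∂/∂φ`. -/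
def rotField (x : Fin 3 → ℝ) : Fin 3 → ℝ := ![-x 1, x 0, 0]

lemma rotField_meridian (α : ℝ) (q : ℝ × ℝ) : rotField (meridian α q) = q.2 • phiHat α := by
  funext i
  fin_cases i <;> simp [rotField, meridian, phiHat]

lemma sq_add_sq_meridian (α : ℝ) (q : ℝ × ℝ) :
    meridian α q 0 ^ 2 + meridian α q 1 ^ 2 = q.2 ^ 2 := by
  simp only [meridian, Matrix.cons_val_zero, Matrix.cons_val_one]
  linear_combination q.2 ^ 2 * Real.sin_sq_add_cos_sq α

/-! ### The metric along a meridian plane and its smooth square root -/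

section Axisymmetric

variable {U : Set (Fin 3 → ℝ)} {M : StationarySpacetime (U \ {0})} {A : ConformalCompletion U M}
  {κ β : (Fin 3 → ℝ) → ℝ}

/-- Off the axis `dρ̃² + dz̃² = 1 - φ̂ ⊗ φ̂` and `ρ̃² dφ² = φ̂ ⊗ φ̂`, with `∂/∂φ = ρ̃ φ̂`. The form
with `∂/∂φ` has polynomial components, convenient to differentiate. -/
lemma IsAxisymmetric.hT_eq_of_ne (hA : IsAxisymmetric A κ β) {x : Fin 3 → ℝ} (hx : x ∈ U)
    (h0 : x 0 ^ 2 + x 1 ^ 2 ≠ 0) : A.hT x = Real.exp (2 * κ x) • (1 +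
      ((Real.exp (-2 * β x) - 1) / (x 0 ^ 2 + x 1 ^ 2)) •
        Matrix.vecMulVec (rotField x) (rotField x)) := by
  have hp : 0 < x 0 ^ 2 + x 1 ^ 2 := lt_of_le_of_ne (by positivity) h0.symm
  have hr : rho x ≠ 0 := (Real.sqrt_pos.2 hp).ne'
  have hr2 : rho x ^ 2 = x 0 ^ 2 + x 1 ^ 2 := Real.sq_sqrt hp.le
  rw [hA.form x hx hr]
  congr 1
  have hsub : x 0 ^ 2 = rho x ^ 2 - x 1 ^ 2 := by linarith
  rw [← hr2]
  ext i j
  fin_cases i <;> fin_cases j <;>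
    simp [dPhi, dRho, dZ, rotField] <;> field_simp <;>
    (try rw [hsub]) <;> ring

/-- On a fixed meridian plane `φ̂` is constant, so the off-axis formula extends to the axis by
continuity. -/
lemma IsAxisymmetric.hT_meridian (hA : IsAxisymmetric A κ β) (α : ℝ) {q : ℝ × ℝ}
    (hq : q ∈ meridianDomain U α) :
    A.hT (meridian α q) = Real.exp (2 * κ (meridian α q)) •
      (1 + (Real.exp (-2 * β (meridian α q)) - 1) •
        Matrix.vecMulVec (phiHat α) (phiHat α)) := by
  have hm := (contDiff_meridian α).continuous.continuousOn (s := meridianDomain U α)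
  have hκ := hA.κ_smooth.continuousOn.comp hm (mapsTo_meridian U α)
  have hβ := hA.β_smooth.continuousOn.comp hm (mapsTo_meridian U α)
  ext i j
  refine eqOn_meridianDomain A.isOpen (α := α)
    (F := fun q => A.hT (meridian α q) i j)
    (H := fun q => (Real.exp (2 * κ (meridian α q)) •
      (1 + (Real.exp (-2 * β (meridian α q)) - 1) •
        Matrix.vecMulVec (phiHat α) (phiHat α))) i j) ?_ ?_ ?_ hq
  · exact (A.hT_smooth i j).continuousOn.comp hm (mapsTo_meridian U α)
  · simp only [Matrix.smul_apply, Matrix.add_apply, smul_eq_mul]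
    refine ContinuousOn.mul ?_ (continuousOn_const.add (ContinuousOn.mul
      (ContinuousOn.sub ?_ continuousOn_const) continuousOn_const))
    · exact Real.continuous_exp.comp_continuousOn (continuousOn_const.mul hκ)
    · exact Real.continuous_exp.comp_continuousOn (continuousOn_const.mul hβ)
  · intro q hq h0
    have h2 : q.2 ^ 2 ≠ 0 := pow_ne_zero 2 h0
    rw [hA.hT_eq_of_ne hq (by rwa [sq_add_sq_meridian]), sq_add_sq_meridian, rotField_meridian]
    simp only [Matrix.smul_apply, Matrix.add_apply, smul_eq_mul, Matrix.vecMulVec_apply,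
      Pi.smul_apply]
    field_simp

lemma IsAxisymmetric.eta_null (hA : IsAxisymmetric A κ β) (α : ℝ) {q : ℝ × ℝ}
    (hq : q ∈ meridianDomain U α) :
    ∑ i, ∑ j, ((A.hT (meridian α q) i j : ℝ) : ℂ) * (eta α i * eta α j) = 0 := by
  have h1 := GerochHansen.eta_null α
  have h2 := phiHat_eta α
  rw [hA.hT_meridian α hq]
  generalize κ (meridian α q) = k
  generalize β (meridian α q) = b
  simp only [Matrix.smul_apply, Matrix.add_apply, smul_eq_mul, Matrix.vecMulVec_apply,
    Complex.ofReal_mul, Complex.ofReal_add, Fin.sum_univ_three] at h1 h2 ⊢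
  linear_combination (Real.exp (2 * k) : ℂ) * h1 + (Real.exp (2 * k) : ℂ) *
    ((Real.exp (-2 * b) - 1 : ℝ) : ℂ) * ((phiHat α 0 : ℂ) * eta α 0 + (phiHat α 1 : ℂ) * eta α 1
      + (phiHat α 2 : ℂ) * eta α 2) * h2

/-- The positive square root of the metric. -/
noncomputable def sqrtFrame (h : (Fin 3 → ℝ) → Matrix (Fin 3) (Fin 3) ℝ) (κ β : (Fin 3 → ℝ) → ℝ)
    (x : Fin 3 → ℝ) : Matrix (Fin 3) (Fin 3) ℝ :=
  Real.exp (κ x) • (1 + (1 + Real.exp (-β x))⁻¹ • (Real.exp (-(2 * κ x)) • h x - 1))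

/-- The root is `e^κ (1 + (e^{-β} - 1) φ̂ ⊗ φ̂)`, but `φ̂` is not smooth at the axis. Since `e^{-2κ}
h̃ - 1 = (e^{-β} - 1)(e^{-β} + 1) φ̂ ⊗ φ̂`, dividing by the positive function `1 + e^{-β}` expresses
the root through `h̃`, `κ`, `β` alone. -/
lemma IsAxisymmetric.isSmoothFrame (hA : IsAxisymmetric A κ β) :
    IsSmoothFrame U A.hT (sqrtFrame A.hT κ β) where
  isFrame x hx := by
    obtain ⟨α, q, rfl⟩ := exists_eq_meridian x
    have hm := hA.hT_meridian α (q := q) hx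
    have hE : sqrtFrame A.hT κ β (meridian α q) = Real.exp (κ (meridian α q)) •
        (1 + (Real.exp (-β (meridian α q)) - 1) •
          Matrix.vecMulVec (phiHat α) (phiHat α)) := by
      rw [sqrtFrame, hm, smul_smul, ← Real.exp_add, neg_add_cancel, Real.exp_zero, one_smul,
        add_sub_cancel_left, smul_smul]
      congr 3
      have : (0 : ℝ) < 1 + Real.exp (-β (meridian α q)) := by positivity
      rw [show -2 * β (meridian α q) = -β (meridian α q) + -β (meridian α q) by ring, Real.exp_add]
      field_simp
      ring
    have heq : A.hT (meridian α q) =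
        (sqrtFrame A.hT κ β (meridian α q)).transpose * sqrtFrame A.hT κ β (meridian α q) := by
      rw [hE, hm]
      simp only [Matrix.transpose_smul, Matrix.transpose_add, Matrix.transpose_one,
        Matrix.transpose_vecMulVec, Matrix.smul_mul, Matrix.mul_smul, smul_smul,
        add_mul, mul_add, one_mul, mul_one, phiHat_mul_self]
      rw [two_mul, Real.exp_add,
        show -2 * β (meridian α q) = -β (meridian α q) + -β (meridian α q) by ring, Real.exp_add]
      module
    refine ⟨?_, heq⟩
    have hdet := (A.hT_posDef _ hx).det_pos
    rw [heq, Matrix.det_mul, Matrix.det_transpose] at hdet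
    exact isUnit_iff_ne_zero.2 (left_ne_zero_of_mul hdet.ne')
  smooth i j := by
    simp only [sqrtFrame, Matrix.smul_apply, Matrix.add_apply, Matrix.sub_apply, smul_eq_mul]
    have hκ := hA.κ_smooth
    have hβ := hA.β_smooth
    refine hκ.exp.mul (contDiffOn_const.add (ContDiffOn.mul (ContDiffOn.inv
      (contDiffOn_const.add hβ.neg.exp) fun x _ => ?_)
      (((contDiffOn_const.mul hκ).neg.exp.mul (A.hT_smooth i j)).sub contDiffOn_const)))
    positivity

/-- The planes at angles `0` and `π/2` both pass through `Λ`, and give `1` and `e^{-2β(Λ)}` for the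
same component; hence `β(Λ) = 0`. -/
lemma IsAxisymmetric.hT_zero (hA : IsAxisymmetric A κ β) : A.hT 0 = 1 := by
  have hm : ∀ α, meridian α (0, 0) = 0 := fun α => by
    funext i
    fin_cases i <;> simp [meridian]
  have hd : ∀ α, ((0 : ℝ), (0 : ℝ)) ∈ meridianDomain U α := fun α => by
    change meridian α (0, 0) ∈ U
    rw [hm]
    exact A.mem_zero
  have h0 := hA.hT_meridian 0 (q := (0, 0)) (hd _)
  have h1 := hA.hT_meridian (Real.pi / 2) (q := (0, 0)) (hd _)
  rw [hm, hA.κ_zero] at h0 h1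
  have h00 := congrFun (congrFun h0 0) 0
  have h10 := congrFun (congrFun h1 0) 0
  rw [h00] at h10
  simp [phiHat] at h10
  rw [h0]
  have : Real.exp (-2 * β 0) - 1 = 0 := by
    simp only [neg_mul]
    simp [← h10]
  rw [this]
  simp

end Axisymmetric

/-! ### The null geodesic field -/

lemma pderiv_ofReal {ι : Type} [Fintype ι] [DecidableEq ι] {f : (ι → ℝ) → ℝ} {x : ι → ℝ}
    (hf : DifferentiableAt ℝ f x) (i : ι) :
    pderiv i (fun y => (f y : ℂ)) x = ((pderiv i f x : ℝ) : ℂ) := by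
  have : HasFDerivAt (fun y => (f y : ℂ)) (Complex.ofRealCLM.comp (fderiv ℝ f x)) x :=
    Complex.ofRealCLM.hasFDerivAt.comp x hf.hasFDerivAt
  rw [pderiv, this.fderiv]
  rfl

/-- The hypothesis is the conclusion with its free index lowered; the first two derivative terms of
`Γ` coincide when contracted with the symmetric `v^i v^j`. -/
lemma sum_christoffel_eq {G : (Fin 3 → ℝ) → Matrix (Fin 3) (Fin 3) ℝ} {x : Fin 3 → ℝ}
    (hdet : (G x).det ≠ 0) {v : Fin 3 → ℂ} {c : ℂ}
    (h : ∀ l, ∑ i, ∑ j, (2 * ((pderiv i (fun y => G y l j) x : ℝ) : ℂ) -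
      ((pderiv l (fun y => G y i j) x : ℝ) : ℂ)) * (v i * v j) = 2 * c * ∑ m, (G x l m : ℂ) * v m)
    (k : Fin 3) : ∑ i, ∑ j, (christoffel G k i j x : ℂ) * (v i * v j) = c * v k := by
  have hinv : ∀ m, ∑ l, (((G x)⁻¹ k l : ℝ) : ℂ) * (G x l m : ℂ) = if k = m then 1 else 0 := by
    intro m
    have := congrFun (congrFun (Matrix.nonsing_inv_mul (G x) (isUnit_iff_ne_zero.2 hdet)) k) m
    rw [Matrix.mul_apply, Matrix.one_apply] at this
    rw [← Complex.ofReal_one, ← Complex.ofReal_zero, ← apply_ite Complex.ofReal, ← this]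
    push_cast
    rfl
  have h1 : ∀ l, ∑ i, ∑ j, (((pderiv i (fun y => G y l j) x : ℝ) : ℂ) +
      ((pderiv j (fun y => G y l i) x : ℝ) : ℂ) - ((pderiv l (fun y => G y i j) x : ℝ) : ℂ)) * (v i * v j) =
      2 * c * ∑ m, (G x l m : ℂ) * v m := by
    intro l
    rw [← h l]
    have : ∑ i, ∑ j, ((pderiv j (fun y => G y l i) x : ℝ) : ℂ) * (v i * v j) =
        ∑ i, ∑ j, ((pderiv i (fun y => G y l j) x : ℝ) : ℂ) * (v i * v j) := by
      rw [Finset.sum_comm]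
      exact Finset.sum_congr rfl fun i _ => Finset.sum_congr rfl fun j _ => by ring
    simp only [add_mul, sub_mul, Finset.sum_add_distrib, Finset.sum_sub_distrib, this, two_mul]
  calc _ = (1 / 2) * ∑ l, (((G x)⁻¹ k l : ℝ) : ℂ) * ∑ i, ∑ j,
        (((pderiv i (fun y => G y l j) x : ℝ) : ℂ) + ((pderiv j (fun y => G y l i) x : ℝ) : ℂ) -
          ((pderiv l (fun y => G y i j) x : ℝ) : ℂ)) * (v i * v j) := by
        simp only [christoffel, Complex.ofReal_mul, Complex.ofReal_sum, Complex.ofReal_add,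
          Complex.ofReal_sub, Finset.mul_sum, Finset.sum_mul]
        conv_rhs => rw [Finset.sum_comm]
        refine Finset.sum_congr rfl fun i _ => ?_
        conv_rhs => rw [Finset.sum_comm]
        refine Finset.sum_congr rfl fun j _ => Finset.sum_congr rfl fun l _ => ?_
        push_cast
        ring
    _ = c * ∑ m, (∑ l, (((G x)⁻¹ k l : ℝ) : ℂ) * (G x l m : ℂ)) * v m := by
        simp only [h1, Finset.mul_sum, Finset.sum_mul]
        rw [Finset.sum_comm]
        refine Finset.sum_congr rfl fun i _ => Finset.sum_congr rfl fun j _ => ?_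
        ring
    _ = c * v k := by
        simp [hinv]

/-- The derivative of the components of `∂/∂φ`. -/
noncomputable def rotFieldDeriv : Fin 3 → (Fin 3 → ℝ) →L[ℝ] ℝ :=
  ![-ContinuousLinearMap.proj 1, ContinuousLinearMap.proj 0, 0]

lemma hasFDerivAt_rotField (i : Fin 3) (x : Fin 3 → ℝ) :
    HasFDerivAt (fun y => rotField y i) (rotFieldDeriv i) x := by
  fin_cases i
  · exact (ContinuousLinearMap.proj (R := ℝ) (φ := fun _ : Fin 3 => ℝ) 1).hasFDerivAt.neg
  · exact (ContinuousLinearMap.proj (R := ℝ) (φ := fun _ : Fin 3 => ℝ) 0).hasFDerivAt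
  · exact hasFDerivAt_const (0 : ℝ) x

/-! ### The geodesic equation for `η` -/

section Axisymmetric

variable {U : Set (Fin 3 → ℝ)} {M : StationarySpacetime (U \ {0})} {A : ConformalCompletion U M}
  {κ β : (Fin 3 → ℝ) → ℝ}

/-- The values of `b` and `db` are left unspecified because their terms drop out of the geodesic
equation. -/
lemma IsAxisymmetric.pderiv_hT (hA : IsAxisymmetric A κ β) {x : Fin 3 → ℝ} (hx : x ∈ U)
    (h0 : x 0 ^ 2 + x 1 ^ 2 ≠ 0) :
    ∃ (b : ℝ) (db : Fin 3 → ℝ),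
      (∀ i j, A.hT x i j = Real.exp (2 * κ x) *
        ((1 : Matrix (Fin 3) (Fin 3) ℝ) i j + b * (rotField x i * rotField x j))) ∧
      ∀ i j k, pderiv k (fun y => A.hT y i j) x = 2 * pderiv k κ x * A.hT x i j +
        Real.exp (2 * κ x) * (db k * (rotField x i * rotField x j) +
          b * (rotFieldDeriv i (Pi.single k 1) * rotField x j +
            rotField x i * rotFieldDeriv j (Pi.single k 1))) := by
  set B : (Fin 3 → ℝ) → ℝ := fun y => (Real.exp (-2 * β y) - 1) / (y 0 ^ 2 + y 1 ^ 2) with hB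
  have hval : ∀ y ∈ U, y 0 ^ 2 + y 1 ^ 2 ≠ 0 → ∀ i j, A.hT y i j = Real.exp (2 * κ y) *
        ((1 : Matrix (Fin 3) (Fin 3) ℝ) i j + B y * (rotField y i * rotField y j)) := by
    intro y hy hy0 i j
    rw [hA.hT_eq_of_ne hy hy0]
    rfl
  refine ⟨B x, fun k => pderiv k B x, hval x hx h0, fun i j k => ?_⟩
  have hκ : DifferentiableAt ℝ κ x :=
    (hA.κ_smooth.contDiffAt (A.isOpen.mem_nhds hx)).differentiableAt (by simp)
  have hβ : DifferentiableAt ℝ β x :=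
    (hA.β_smooth.contDiffAt (A.isOpen.mem_nhds hx)).differentiableAt (by simp)
  have hBd : DifferentiableAt ℝ B x := by
    have hden : DifferentiableAt ℝ (fun y : Fin 3 → ℝ => y 0 ^ 2 + y 1 ^ 2) x := by fun_prop
    simp only [hB, div_eq_mul_inv]
    exact ((hβ.const_mul _).exp.sub_const _).mul (hden.inv h0)
  have hev : (fun y => A.hT y i j) =ᶠ[nhds x] fun y => Real.exp (2 * κ y) *
      ((1 : Matrix (Fin 3) (Fin 3) ℝ) i j + B y * (rotField y i * rotField y j)) := by
    have hopen : IsOpen {y : Fin 3 → ℝ | y 0 ^ 2 + y 1 ^ 2 ≠ 0} :=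
      isOpen_ne_fun (by fun_prop) continuous_const
    filter_upwards [A.isOpen.mem_nhds hx, hopen.mem_nhds h0] with y hy hy0
    exact hval y hy hy0 i j
  have hd : HasFDerivAt (fun y => Real.exp (2 * κ y) *
      ((1 : Matrix (Fin 3) (Fin 3) ℝ) i j + B y * (rotField y i * rotField y j))) _ x :=
    ((hκ.hasFDerivAt.const_mul 2).exp).mul ((hBd.hasFDerivAt.mul
    ((hasFDerivAt_rotField i x).mul (hasFDerivAt_rotField j x))).const_add
      ((1 : Matrix (Fin 3) (Fin 3) ℝ) i j))
  rw [pderiv, hev.fderiv_eq, HasFDerivAt.fderiv hd, hval x hx h0 i j]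
  simp only [add_apply, smul_apply, smul_eq_mul, pderiv, Pi.mul_apply]
  ring

lemma IsAxisymmetric.sum_christoffel_eta_of_ne (hA : IsAxisymmetric A κ β) (α : ℝ) {q : ℝ × ℝ}
    (hq : q ∈ meridianDomain U α) (h0 : q.2 ≠ 0) (k : Fin 3) :
    ∑ i, ∑ j, (christoffel A.hT k i j (meridian α q) : ℂ) * (eta α i * eta α j) =
      (2 * ∑ i, eta α i * ((pderiv i κ (meridian α q) : ℝ) : ℂ)) * eta α k := by
  obtain ⟨b, db, hval, hder⟩ := hA.pderiv_hT (x := meridian α q) hq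
    (by rw [sq_add_sq_meridian]; exact pow_ne_zero 2 h0)
  refine sum_christoffel_eq (A.hT_posDef _ hq).det_pos.ne' (fun l => ?_) k
  -- Only `η·η = 0` and `w·η = 0`, with `w = ∂/∂φ`, are needed. Every term with `b` or `db` contains
  -- `w·η`, except those with `η^i η^j ∂_i w_j`, which vanish because `∂_i w_j` is antisymmetric.
  -- What remains comes from `∂κ`.
  have hN := GerochHansen.eta_null α
  have hS : ∑ i, (rotField (meridian α q) i : ℂ) * eta α i = 0 := by
    rw [rotField_meridian]
    have := phiHat_eta α
    simp only [Fin.sum_univ_three, Pi.smul_apply, smul_eq_mul, Complex.ofReal_mul] at this ⊢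
    linear_combination (q.2 : ℂ) * this
  simp only [hder, hval]
  generalize meridian α q = x at *
  have hw : rotField x 2 = 0 := rfl
  generalize eta α = v at *
  generalize rotField x = w at *
  generalize Real.exp (2 * κ x) = e at *
  generalize hK : (fun i => pderiv i κ x) = K
  have hK' : ∀ i, pderiv i κ x = K i := fun i => congrFun hK i
  simp only [hK']
  simp only [Fin.sum_univ_three, Matrix.one_apply, hw] at hN hS
  simp at hN hS
  fin_cases l
  · simp [Fin.sum_univ_three, rotFieldDeriv, Matrix.one_apply, hw, Pi.single_apply]
    linear_combination (e : ℂ) * (2 * (db 0 * v 0 + db 1 * v 1 + db 2 * v 2) * w 0 - 2 * b * v 1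
      - 2 * K 0 * b * (w 0 * v 0 + w 1 * v 1) - db 0 * (w 0 * v 0 + w 1 * v 1) - 2 * b * v 1) * hS
      - 2 * K 0 * e * hN
  · simp [Fin.sum_univ_three, rotFieldDeriv, Matrix.one_apply, hw, Pi.single_apply]
    linear_combination (e : ℂ) * (2 * (db 0 * v 0 + db 1 * v 1 + db 2 * v 2) * w 1 + 2 * b * v 0
      - 2 * K 1 * b * (w 0 * v 0 + w 1 * v 1) - db 1 * (w 0 * v 0 + w 1 * v 1) + 2 * b * v 0) * hS
      - 2 * K 1 * e * hN
  · simp [Fin.sum_univ_three, rotFieldDeriv, Matrix.one_apply, hw]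
    linear_combination (e : ℂ) * (- 2 * K 2 * b * (w 0 * v 0 + w 1 * v 1)
      - db 2 * (w 0 * v 0 + w 1 * v 1)) * hS - 2 * K 2 * e * hN

lemma IsAxisymmetric.sum_christoffel_eta (hA : IsAxisymmetric A κ β) (α : ℝ) {q : ℝ × ℝ}
    (hq : q ∈ meridianDomain U α) (k : Fin 3) :
    ∑ i, ∑ j, (christoffel A.hT k i j (meridian α q) : ℂ) * (eta α i * eta α j) =
      (2 * ∑ i, eta α i * ((pderiv i κ (meridian α q) : ℝ) : ℂ)) * eta α k := by
  have hc : ∀ {f : (Fin 3 → ℝ) → ℝ}, ContDiffOn ℝ ∞ f U →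
      ContinuousOn (fun q => (f (meridian α q) : ℂ)) (meridianDomain U α) := fun hf =>
    Complex.continuous_ofReal.comp_continuousOn (hf.continuousOn.comp
      (contDiff_meridian α).continuous.continuousOn (mapsTo_meridian U α))
  refine eqOn_meridianDomain A.isOpen (α := α)
    (F := fun q => ∑ i, ∑ j, (christoffel A.hT k i j (meridian α q) : ℂ) * (eta α i * eta α j))
    (H := fun q => (2 * ∑ i, eta α i * ((pderiv i κ (meridian α q) : ℝ) : ℂ)) * eta α k) ?_ ?_
    (fun q hq h0 => hA.sum_christoffel_eta_of_ne α hq h0 k) hq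
  · refine continuousOn_finsetSum _ fun i _ => continuousOn_finsetSum _ fun j _ => ?_
    exact (hc (contDiffOn_christoffel A.isOpen A.hT_smooth
      (fun x hx => (A.hT_posDef x hx).det_pos.ne') k i j)).mul continuousOn_const
  · refine (continuousOn_const.mul (continuousOn_finsetSum _ fun i _ => ?_)).mul continuousOn_const
    exact continuousOn_const.mul (hc (contDiffOn_pderiv A.isOpen hA.κ_smooth i))

lemma etaD_comp_meridian {F : (Fin 3 → ℝ) → ℂ} {α : ℝ} {q : ℝ × ℝ}
    (hF : DifferentiableAt ℝ F (meridian α q)) :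
    etaD (fun q' => F (meridian α q')) q = ∑ i, eta α i * pderiv i F (meridian α q) := by
  have hm : HasFDerivAt (meridian α) (fderiv ℝ (meridian α) q) q :=
    ((contDiff_meridian α).differentiable (by simp) q).hasFDerivAt
  have hcoord : ∀ u : ℝ × ℝ, fderiv ℝ (meridian α) q u = meridian α u := by
    intro u
    let L : ℝ × ℝ →L[ℝ] (Fin 3 → ℝ) := LinearMap.toContinuousLinearMap
      { toFun := meridian α
        map_add' := fun x y => by
          funext i
          fin_cases i <;> simp [meridian, add_mul]
        map_smul' := fun c x => by
          funext i
          fin_cases i <;> simp [meridian, mul_assoc] }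
    exact congrArg (fun T => T u) (L.hasFDerivAt (x := q)).fderiv
  have hcomp : HasFDerivAt (fun q' => F (meridian α q')) _ q := hF.hasFDerivAt.comp q hm
  have hsum : ∀ u : Fin 3 → ℝ, fderiv ℝ F (meridian α q) u =
      ∑ i, (u i : ℂ) * pderiv i F (meridian α q) := by
    intro u
    conv_lhs => rw [pi_eq_sum_univ' u]
    rw [map_sum]
    refine Finset.sum_congr rfl fun i _ => ?_
    rw [map_smul, pderiv, Complex.real_smul]
  rw [etaD, hcomp.fderiv]
  simp only [ContinuousLinearMap.comp_apply, hcoord, hsum, Fin.sum_univ_three]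
  simp [meridian, eta]
  ring

end Axisymmetric

/-! ### Invariance of the Ricci tensor under linear isometries -/

section Multilinear

variable {ι : Type} [Fintype ι]

/-- The bilinear form with components `T`. -/
noncomputable def bi (T : ι → ι → ℝ) (u v : ι → ℝ) : ℝ := ∑ i, u i * ∑ j, v j * T i j

/-- The trilinear form with components `T`. -/
noncomputable def tri (T : ι → ι → ι → ℝ) (u v w : ι → ℝ) : ℝ := ∑ i, u i * bi (T i) v w

/-- The quadrilinear form with components `T`. -/
noncomputable def quad (T : ι → ι → ι → ι → ℝ) (m u v w : ι → ℝ) : ℝ := ∑ i, m i * tri (T i) u v w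

lemma bi_add_left (T : ι → ι → ℝ) (u u' v : ι → ℝ) : bi T (u + u') v = bi T u v + bi T u' v := by
  simp [bi, add_mul, Finset.sum_add_distrib]

lemma bi_smul_left (T : ι → ι → ℝ) (c : ℝ) (u v : ι → ℝ) : bi T (c • u) v = c * bi T u v := by
  simp [bi, mul_assoc, Finset.mul_sum]

lemma bi_add_right (T : ι → ι → ℝ) (u v v' : ι → ℝ) : bi T u (v + v') = bi T u v + bi T u v' := by
  simp [bi, add_mul, mul_add, Finset.sum_add_distrib]

lemma bi_smul_right (T : ι → ι → ℝ) (c : ℝ) (u v : ι → ℝ) : bi T u (c • v) = c * bi T u v := by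
  simp [bi, mul_assoc, mul_left_comm _ c, Finset.mul_sum]

lemma tri_add_fst (T : ι → ι → ι → ℝ) (u u' v w : ι → ℝ) :
    tri T (u + u') v w = tri T u v w + tri T u' v w := by
  simp [tri, add_mul, Finset.sum_add_distrib]

lemma tri_smul_fst (T : ι → ι → ι → ℝ) (c : ℝ) (u v w : ι → ℝ) :
    tri T (c • u) v w = c * tri T u v w := by
  simp [tri, mul_assoc, Finset.mul_sum]

lemma tri_add_snd (T : ι → ι → ι → ℝ) (u v v' w : ι → ℝ) :
    tri T u (v + v') w = tri T u v w + tri T u v' w := by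
  simp [tri, mul_add, bi_add_left, Finset.sum_add_distrib]

lemma tri_smul_snd (T : ι → ι → ι → ℝ) (c : ℝ) (u v w : ι → ℝ) :
    tri T u (c • v) w = c * tri T u v w := by
  simp [tri, bi_smul_left, mul_left_comm _ c, Finset.mul_sum]

lemma tri_add_trd (T : ι → ι → ι → ℝ) (u v w w' : ι → ℝ) :
    tri T u v (w + w') = tri T u v w + tri T u v w' := by
  simp [tri, mul_add, bi_add_right, Finset.sum_add_distrib]

lemma tri_smul_trd (T : ι → ι → ι → ℝ) (c : ℝ) (u v w : ι → ℝ) :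
    tri T u v (c • w) = c * tri T u v w := by
  simp [tri, bi_smul_right, mul_left_comm _ c, Finset.mul_sum]

lemma quad_add_zeroth (T : ι → ι → ι → ι → ℝ) (m m' u v w : ι → ℝ) :
    quad T (m + m') u v w = quad T m u v w + quad T m' u v w := by
  simp [quad, add_mul, Finset.sum_add_distrib]

lemma quad_smul_zeroth (T : ι → ι → ι → ι → ℝ) (c : ℝ) (m u v w : ι → ℝ) :
    quad T (c • m) u v w = c * quad T m u v w := by
  simp [quad, mul_assoc, Finset.mul_sum]

lemma quad_add_fst (T : ι → ι → ι → ι → ℝ) (m u u' v w : ι → ℝ) :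
    quad T m (u + u') v w = quad T m u v w + quad T m u' v w := by
  simp [quad, mul_add, tri_add_fst, Finset.sum_add_distrib]

lemma quad_smul_fst (T : ι → ι → ι → ι → ℝ) (c : ℝ) (m u v w : ι → ℝ) :
    quad T m (c • u) v w = c * quad T m u v w := by
  simp [quad, tri_smul_fst, mul_left_comm _ c, Finset.mul_sum]

lemma quad_add_snd (T : ι → ι → ι → ι → ℝ) (m u v v' w : ι → ℝ) :
    quad T m u (v + v') w = quad T m u v w + quad T m u v' w := by
  simp [quad, mul_add, tri_add_snd, Finset.sum_add_distrib]

lemma quad_smul_snd (T : ι → ι → ι → ι → ℝ) (c : ℝ) (m u v w : ι → ℝ) :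
    quad T m u (c • v) w = c * quad T m u v w := by
  simp [quad, tri_smul_snd, mul_left_comm _ c, Finset.mul_sum]

lemma quad_add_trd (T : ι → ι → ι → ι → ℝ) (m u v w w' : ι → ℝ) :
    quad T m u v (w + w') = quad T m u v w + quad T m u v w' := by
  simp [quad, mul_add, tri_add_trd, Finset.sum_add_distrib]

lemma quad_smul_trd (T : ι → ι → ι → ι → ℝ) (c : ℝ) (m u v w : ι → ℝ) :
    quad T m u v (c • w) = c * quad T m u v w := by
  simp [quad, tri_smul_trd, mul_left_comm _ c, Finset.mul_sum]

lemma bi_eq_dotProduct (T : Matrix ι ι ℝ) (u v : ι → ℝ) : bi T u v = u ⬝ᵥ T.mulVec v := by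
  simp only [bi, dotProduct, Matrix.mulVec]
  exact Finset.sum_congr rfl fun i _ => by
    congr 1
    exact Finset.sum_congr rfl fun j _ => mul_comm _ _

/-- `B` is bilinear. -/
structure IsBilin (B : (ι → ℝ) → (ι → ℝ) → ℝ) : Prop where
  left : ∀ v, IsLinearMap ℝ fun u => B u v
  right : ∀ u, IsLinearMap ℝ (B u)

variable [DecidableEq ι]

lemma bi_single (T : ι → ι → ℝ) (i j : ι) : bi T (Pi.single i 1) (Pi.single j 1) = T i j := by
  simp [bi, Pi.single_apply]

lemma tri_single (T : ι → ι → ι → ℝ) (i j k : ι) :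
    tri T (Pi.single i 1) (Pi.single j 1) (Pi.single k 1) = T i j k := by
  simp [tri, bi_single, Pi.single_apply]

lemma quad_single (T : ι → ι → ι → ι → ℝ) (i j k l : ι) :
    quad T (Pi.single i 1) (Pi.single j 1) (Pi.single k 1) (Pi.single l 1) = T i j k l := by
  simp [quad, tri_single, Pi.single_apply]

lemma isLinearMap_eq_sum {f : (ι → ℝ) → ℝ} (hf : IsLinearMap ℝ f) (u : ι → ℝ) :
    f u = ∑ i, u i * f (Pi.single i 1) := by
  have h := (IsLinearMap.mk' f hf).pi_apply_eq_sum_univ u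
  simp only [IsLinearMap.mk'_apply, smul_eq_mul] at h
  rw [h]
  refine Finset.sum_congr rfl fun i _ => ?_
  congr 2
  funext j
  simp [Pi.single_apply, eq_comm]

lemma IsBilin.eq_bi {B : (ι → ℝ) → (ι → ℝ) → ℝ} (hB : IsBilin B) (u v : ι → ℝ) :
    B u v = bi (fun i j => B (Pi.single i 1) (Pi.single j 1)) u v := by
  rw [isLinearMap_eq_sum (hB.left v) u]
  exact Finset.sum_congr rfl fun i _ => by rw [isLinearMap_eq_sum (hB.right _) v]

/-- The trace of a bilinear form is the same in every orthonormal basis. -/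
lemma IsBilin.sum_orthogonal {B : (ι → ℝ) → (ι → ℝ) → ℝ} (hB : IsBilin B) {R : Matrix ι ι ℝ}
    (hR : R * R.transpose = 1) :
    ∑ k, B (R.mulVec (Pi.single k 1)) (R.mulVec (Pi.single k 1)) =
      ∑ k, B (Pi.single k 1) (Pi.single k 1) := by
  have h : ∀ a c, ∑ k, R a k * R c k = if a = c then 1 else 0 := by
    intro a c
    have := congrFun (congrFun hR a) c
    rwa [Matrix.mul_apply, Matrix.one_apply] at this
  rw [Finset.sum_congr rfl fun k _ =>
    hB.eq_bi (R.mulVec (Pi.single k 1)) (R.mulVec (Pi.single k 1))]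
  simp only [bi, Matrix.mulVec_single_one, Matrix.col_apply, Finset.mul_sum]
  rw [Finset.sum_comm]
  refine Finset.sum_congr rfl fun a _ => ?_
  rw [Finset.sum_comm]
  simp only [← mul_assoc, ← Finset.sum_mul, h]
  simp

lemma fderiv_apply_eq_sum_pderiv {f : (ι → ℝ) → ℝ} (x m : ι → ℝ) :
    fderiv ℝ f x m = ∑ i, m i * pderiv i f x :=
  isLinearMap_eq_sum (fderiv ℝ f x).toLinearMap.isLinear m

lemma fderiv_bi {T : (ι → ℝ) → ι → ι → ℝ} {x : ι → ℝ}
    (hT : ∀ i j, DifferentiableAt ℝ (fun y => T y i j) x) (m u v : ι → ℝ) :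
    fderiv ℝ (fun y => bi (T y) u v) x m =
      tri (fun s i j => pderiv s (fun y => T y i j) x) m u v := by
  rw [fderiv_apply_eq_sum_pderiv]
  refine Finset.sum_congr rfl fun s _ => ?_
  congr 1
  have h : HasFDerivAt (fun y => bi (T y) u v)
      (∑ i, u i • ∑ j, v j • fderiv ℝ (fun y => T y i j) x) x :=
    HasFDerivAt.fun_sum fun i _ => (HasFDerivAt.fun_sum fun j _ =>
      (hT i j).hasFDerivAt.const_mul (v j)).const_mul (u i)
  rw [pderiv, h.fderiv]
  simp [bi, pderiv, sum_apply]

lemma fderiv_tri {T : (ι → ℝ) → ι → ι → ι → ℝ} {x : ι → ℝ}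
    (hT : ∀ k i j, DifferentiableAt ℝ (fun y => T y k i j) x) (m u v w : ι → ℝ) :
    fderiv ℝ (fun y => tri (T y) u v w) x m =
      quad (fun s k i j => pderiv s (fun y => T y k i j) x) m u v w := by
  rw [fderiv_apply_eq_sum_pderiv]
  refine Finset.sum_congr rfl fun s _ => ?_
  congr 1
  have h : HasFDerivAt (fun y => tri (T y) u v w)
      (∑ k, u k • ∑ i, v i • ∑ j, w j • fderiv ℝ (fun y => T y k i j) x) x :=
    HasFDerivAt.fun_sum fun k _ => (HasFDerivAt.fun_sum fun i _ => (HasFDerivAt.fun_sum fun j _ =>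
      (hT k i j).hasFDerivAt.const_mul (w j)).const_mul (v i)).const_mul (u k)
  rw [pderiv, h.fderiv]
  simp [tri, bi, pderiv, sum_apply]

end Multilinear

lemma fderiv_comp_mulVec {ι : Type} [Fintype ι] {U : Set (ι → ℝ)} {R : Matrix ι ι ℝ}
    {f g : (ι → ℝ) → ℝ} (hU : IsOpen U)
    (hf : DifferentiableOn ℝ f U) (hRU : ∀ x ∈ U, R.mulVec x ∈ U)
    (hfg : ∀ x ∈ U, g x = f (R.mulVec x)) {x : ι → ℝ} (hx : x ∈ U)
    (m : ι → ℝ) : fderiv ℝ g x m = fderiv ℝ f (R.mulVec x) (R.mulVec m) := by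
  have h1 : g =ᶠ[nhds x] fun y => f (R.mulVec y) := by
    filter_upwards [hU.mem_nhds hx] with y hy using hfg y hy
  have h2 : HasFDerivAt (fun y => f (R.mulVec y)) _ x :=
    ((hf _ (hRU x hx)).differentiableAt (hU.mem_nhds (hRU x hx))).hasFDerivAt.comp x
      (LinearMap.toContinuousLinearMap R.mulVecLin).hasFDerivAt
  rw [h1.fderiv_eq, h2.fderiv]
  rfl

section Isometry

variable {ι : Type} [Fintype ι] [DecidableEq ι] {U : Set (ι → ℝ)} {G : (ι → ℝ) → Matrix ι ι ℝ}
  {R : Matrix ι ι ℝ}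

/-- Index-free form of the Christoffel symbols, so that their behaviour under `R` follows from that
of the metric derivatives. -/
lemma tri_christoffel (x u v w : ι → ℝ) :
    tri (fun k i j => christoffel G k i j x) u v w = (1 / 2) *
      (tri (fun s i j => pderiv s (fun y => G y i j) x) v (((G x)⁻¹).vecMul u) w +
        tri (fun s i j => pderiv s (fun y => G y i j) x) w (((G x)⁻¹).vecMul u) v -
        tri (fun s i j => pderiv s (fun y => G y i j) x) (((G x)⁻¹).vecMul u) v w) := by
  set p := ((G x)⁻¹).vecMul u with hp
  set D : ι → ι → ι → ℝ := fun s i j => pderiv s (fun y => G y i j) x with hD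
  have h1 : tri D v p w = ∑ l, p l * ∑ i, v i * ∑ j, w j * D i l j := by
    simp only [tri, bi, Finset.mul_sum]
    rw [Finset.sum_comm]
    exact Finset.sum_congr rfl fun _ _ => Finset.sum_congr rfl fun _ _ =>
      Finset.sum_congr rfl fun _ _ => by ring
  have h2 : tri D w p v = ∑ l, p l * ∑ i, v i * ∑ j, w j * D j l i := by
    simp only [tri, bi, Finset.mul_sum]
    rw [Finset.sum_comm]
    refine Finset.sum_congr rfl fun l _ => ?_
    rw [Finset.sum_comm]
    exact Finset.sum_congr rfl fun _ _ => Finset.sum_congr rfl fun _ _ => by ring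
  have h3 : tri D p v w = ∑ l, p l * ∑ i, v i * ∑ j, w j * D l i j := rfl
  rw [h1, h2, h3, ← Finset.sum_add_distrib, ← Finset.sum_sub_distrib]
  have h4 : ∀ l, p l * (∑ i, v i * ∑ j, w j * D i l j) + p l * (∑ i, v i * ∑ j, w j * D j l i) -
      p l * (∑ i, v i * ∑ j, w j * D l i j) =
      p l * ∑ i, v i * ∑ j, w j * (D i l j + D j l i - D l i j) := by
    intro l
    simp only [mul_sub, mul_add, Finset.sum_add_distrib, Finset.sum_sub_distrib]
  simp only [h4]
  have h5 : ∀ X : ι → ℝ, ∑ l, p l * X l = ∑ k, u k * ∑ l, (G x)⁻¹ k l * X l := by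
    intro X
    simp only [hp, Matrix.vecMul, dotProduct, Finset.mul_sum, Finset.sum_mul]
    rw [Finset.sum_comm]
    exact Finset.sum_congr rfl fun _ _ => Finset.sum_congr rfl fun _ _ => by ring
  rw [h5, tri, Finset.mul_sum]
  refine Finset.sum_congr rfl fun k _ => ?_
  rw [mul_left_comm]
  congr 1
  simp only [bi, christoffel, Finset.mul_sum]
  conv_rhs => rw [Finset.sum_comm]
  refine Finset.sum_congr rfl fun i _ => ?_
  conv_rhs => rw [Finset.sum_comm]
  exact Finset.sum_congr rfl fun j _ => Finset.sum_congr rfl fun l _ => by ring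

/-- `R` is a linear isometry of the metric `G` on the open set `U`. -/
structure IsLinearIsometry (U : Set (ι → ℝ)) (G : (ι → ℝ) → Matrix ι ι ℝ) (R : Matrix ι ι ℝ) :
    Prop where
  orthogonal : R * R.transpose = 1
  mapsTo : ∀ x ∈ U, R.mulVec x ∈ U
  metric : ∀ x ∈ U, G x = R.transpose * G (R.mulVec x) * R

lemma IsLinearIsometry.tri_pderiv (hR : IsLinearIsometry U G R) (hU : IsOpen U)
    (hG : ∀ i j, ContDiffOn ℝ ∞ (fun x => G x i j) U) {x : ι → ℝ} (hx : x ∈ U) (m u v : ι → ℝ) :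
    tri (fun s i j => pderiv s (fun y => G y i j) x) m u v =
      tri (fun s i j => pderiv s (fun y => G y i j) (R.mulVec x)) (R.mulVec m) (R.mulVec u)
        (R.mulVec v) := by
  have hd : ∀ x ∈ U, ∀ i j, DifferentiableAt ℝ (fun y => G y i j) x := fun x hx i j =>
    ((hG i j).contDiffAt (hU.mem_nhds hx)).differentiableAt (by simp)
  rw [← fderiv_bi (hd x hx), ← fderiv_bi (hd _ (hR.mapsTo x hx))]
  refine fderiv_comp_mulVec hU (fun y hy => ?_) hR.mapsTo (fun y hy => ?_) hx m
  · have : DifferentiableAt ℝ (fun y => bi (G y) (R.mulVec u) (R.mulVec v)) y :=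
      DifferentiableAt.fun_sum fun i _ => (DifferentiableAt.fun_sum fun j _ =>
        (hd y hy i j).const_mul _).const_mul _
    exact this.differentiableWithinAt
  · rw [bi_eq_dotProduct, bi_eq_dotProduct, hR.metric y hy, ← Matrix.mulVec_mulVec,
      ← Matrix.mulVec_mulVec, Matrix.dotProduct_mulVec, Matrix.vecMul_transpose]

/-- A linear map has no second derivatives, so the inhomogeneous term of the transformation law is
absent; orthogonality lets the upper slot transform by `R` as well. -/
lemma IsLinearIsometry.tri_christoffel (hR : IsLinearIsometry U G R) (hU : IsOpen U)
    (hG : ∀ i j, ContDiffOn ℝ ∞ (fun x => G x i j) U) {x : ι → ℝ} (hx : x ∈ U) (u v w : ι → ℝ) :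
    tri (fun k i j => christoffel G k i j x) u v w =
      tri (fun k i j => christoffel G k i j (R.mulVec x)) (R.mulVec u) (R.mulVec v)
        (R.mulVec w) := by
  have hRR : R.transpose * R = 1 := mul_eq_one_comm.1 hR.orthogonal
  have hinv : (G x)⁻¹ = R.transpose * (G (R.mulVec x))⁻¹ * R := by
    rw [hR.metric x hx, Matrix.mul_inv_rev, Matrix.mul_inv_rev, Matrix.inv_eq_left_inv hRR,
      Matrix.inv_eq_left_inv hR.orthogonal, ← mul_assoc]
  have hp : R.mulVec ((G x)⁻¹.vecMul u) = (G (R.mulVec x))⁻¹.vecMul (R.mulVec u) := by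
    rw [← Matrix.vecMul_transpose R, Matrix.vecMul_vecMul, hinv, mul_assoc, hR.orthogonal, mul_one,
      ← Matrix.vecMul_vecMul, Matrix.vecMul_transpose]
  rw [GerochHansen.tri_christoffel, GerochHansen.tri_christoffel, hR.tri_pderiv hU hG hx,
    hR.tri_pderiv hU hG hx, hR.tri_pderiv hU hG hx, hp]

lemma IsLinearIsometry.quad_christoffel (hR : IsLinearIsometry U G R) (hU : IsOpen U)
    (hG : ∀ i j, ContDiffOn ℝ ∞ (fun x => G x i j) U) (hdet : ∀ x ∈ U, (G x).det ≠ 0)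
    {x : ι → ℝ} (hx : x ∈ U) (m u v w : ι → ℝ) :
    quad (fun s k i j => pderiv s (christoffel G k i j) x) m u v w =
      quad (fun s k i j => pderiv s (christoffel G k i j) (R.mulVec x)) (R.mulVec m) (R.mulVec u)
        (R.mulVec v) (R.mulVec w) := by
  have hd : ∀ x ∈ U, ∀ k i j, DifferentiableAt ℝ (christoffel G k i j) x := fun x hx k i j =>
    ((contDiffOn_christoffel hU hG hdet k i j).contDiffAt (hU.mem_nhds hx)).differentiableAt
      (by simp)
  rw [← fderiv_tri (hd x hx), ← fderiv_tri (hd _ (hR.mapsTo x hx))]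
  refine fderiv_comp_mulVec hU (fun y hy => ?_) hR.mapsTo
    (fun y hy => hR.tri_christoffel hU hG hy u v w) hx m
  have : DifferentiableAt ℝ (fun y => tri (fun k i j => christoffel G k i j y) (R.mulVec u)
      (R.mulVec v) (R.mulVec w)) y :=
    DifferentiableAt.fun_sum fun k _ => (DifferentiableAt.fun_sum fun i _ =>
      (DifferentiableAt.fun_sum fun j _ =>
        (hd y hy k i j).const_mul _).const_mul _).const_mul _
  exact this.differentiableWithinAt

theorem IsLinearIsometry.ricci_eq (hR : IsLinearIsometry U G R) (hU : IsOpen U)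
    (hG : ∀ i j, ContDiffOn ℝ ∞ (fun x => G x i j) U) (hdet : ∀ x ∈ U, (G x).det ≠ 0)
    {x : ι → ℝ} (hx : x ∈ U) (i j : ι) :
    ricci G x i j = bi (ricci G (R.mulVec x)) (R.mulVec (Pi.single i 1))
      (R.mulVec (Pi.single j 1)) := by
  have h1 := hR.tri_christoffel hU hG hx
  have h2 := hR.quad_christoffel hU hG hdet hx
  set Γ : ι → ι → ι → ℝ := fun k i j => christoffel G k i j (R.mulVec x) with hΓ
  set D : ι → ι → ι → ι → ℝ := fun s k i j => pderiv s (christoffel G k i j) (R.mulVec x) with hD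
  let e : ι → ι → ℝ := fun k => Pi.single k 1
  -- The Ricci formula at `R x` with its contractions taken over a basis `e`. The isometry turns
  -- `ricci G x` into this expression for the basis `R e_k`, and each contraction is insensitive to
  -- that change of basis.
  let ric : (ι → ι → ℝ) → (ι → ℝ) → (ι → ℝ) → ℝ := fun e v w =>
    ∑ k, (quad D (e k) (e k) v w - quad D w (e k) v (e k)) +
      ∑ k, ∑ l, (tri Γ (e k) (e k) (e l) * tri Γ (e l) v w -
        tri Γ (e k) w (e l) * tri Γ (e l) v (e k))
  have hric : IsBilin (ric e) := by
    refine ⟨fun w => ⟨fun v v' => ?_, fun c v => ?_⟩, fun v => ⟨fun w w' => ?_, fun c w => ?_⟩⟩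
    · simp only [ric, quad_add_snd, tri_add_snd, mul_add, Finset.sum_sub_distrib,
        Finset.sum_add_distrib]
      ring
    · simp only [ric, quad_smul_snd, tri_smul_snd, mul_left_comm _ c, Finset.sum_sub_distrib,
        ← Finset.mul_sum, smul_eq_mul]
      ring
    · simp only [ric, quad_add_trd, quad_add_zeroth, tri_add_snd, tri_add_trd, mul_add, add_mul,
        Finset.sum_sub_distrib, Finset.sum_add_distrib]
      ring
    · simp only [ric, quad_smul_trd, quad_smul_zeroth, tri_smul_snd, tri_smul_trd,
        mul_left_comm _ c, mul_assoc c, Finset.sum_sub_distrib, ← Finset.mul_sum, smul_eq_mul]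
      ring
  have hframe : ∀ v w, ric (fun k => R.mulVec (e k)) v w = ric e v w := by
    intro v w
    simp only [ric, Finset.sum_sub_distrib]
    have t1 : ∑ k, quad D (R.mulVec (e k)) (R.mulVec (e k)) v w = ∑ k, quad D (e k) (e k) v w :=
      IsBilin.sum_orthogonal (B := fun a b => quad D a b v w)
        ⟨fun _ => ⟨fun _ _ => quad_add_zeroth .., fun _ _ => quad_smul_zeroth ..⟩,
          fun _ => ⟨fun _ _ => quad_add_fst .., fun _ _ => quad_smul_fst ..⟩⟩ hR.orthogonal
    have t2 : ∑ k, quad D w (R.mulVec (e k)) v (R.mulVec (e k)) = ∑ k, quad D w (e k) v (e k) :=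
      IsBilin.sum_orthogonal (B := fun a b => quad D w a v b)
        ⟨fun _ => ⟨fun _ _ => quad_add_fst .., fun _ _ => quad_smul_fst ..⟩,
          fun _ => ⟨fun _ _ => quad_add_trd .., fun _ _ => quad_smul_trd ..⟩⟩ hR.orthogonal
    have t3 : ∀ a b, ∑ l, tri Γ a b (R.mulVec (e l)) * tri Γ (R.mulVec (e l)) v w =
        ∑ l, tri Γ a b (e l) * tri Γ (e l) v w := fun a b =>
      IsBilin.sum_orthogonal (B := fun c d => tri Γ a b c * tri Γ d v w)
        ⟨fun _ => ⟨fun _ _ => by rw [tri_add_trd, add_mul],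
            fun _ _ => by rw [tri_smul_trd, smul_eq_mul, mul_assoc]⟩,
          fun _ => ⟨fun _ _ => by rw [tri_add_fst, mul_add],
            fun _ _ => by rw [tri_smul_fst, smul_eq_mul, mul_left_comm]⟩⟩ hR.orthogonal
    have t4 : ∀ a, ∑ k, tri Γ (R.mulVec (e k)) (R.mulVec (e k)) a = ∑ k, tri Γ (e k) (e k) a :=
      fun a => IsBilin.sum_orthogonal (B := fun c d => tri Γ c d a)
        ⟨fun _ => ⟨fun _ _ => tri_add_fst .., fun _ _ => tri_smul_fst ..⟩,
          fun _ => ⟨fun _ _ => tri_add_snd .., fun _ _ => tri_smul_snd ..⟩⟩ hR.orthogonal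
    have t5 : ∀ a b, ∑ k, tri Γ a w (R.mulVec (e k)) * tri Γ (R.mulVec (e k)) v b =
        ∑ k, tri Γ a w (e k) * tri Γ (e k) v b := fun a b =>
      IsBilin.sum_orthogonal (B := fun c d => tri Γ a w c * tri Γ d v b)
        ⟨fun _ => ⟨fun _ _ => by rw [tri_add_trd, add_mul],
            fun _ _ => by rw [tri_smul_trd, smul_eq_mul, mul_assoc]⟩,
          fun _ => ⟨fun _ _ => by rw [tri_add_fst, mul_add],
            fun _ _ => by rw [tri_smul_fst, smul_eq_mul, mul_left_comm]⟩⟩ hR.orthogonal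
    have t6 : ∀ a, ∑ k, tri Γ (R.mulVec (e k)) w a * tri Γ a v (R.mulVec (e k)) =
        ∑ k, tri Γ (e k) w a * tri Γ a v (e k) := fun a =>
      IsBilin.sum_orthogonal (B := fun c d => tri Γ c w a * tri Γ a v d)
        ⟨fun _ => ⟨fun _ _ => by rw [tri_add_fst, add_mul],
            fun _ _ => by rw [tri_smul_fst, smul_eq_mul, mul_assoc]⟩,
          fun _ => ⟨fun _ _ => by rw [tri_add_trd, mul_add],
            fun _ _ => by rw [tri_smul_trd, smul_eq_mul, mul_left_comm]⟩⟩ hR.orthogonal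
    rw [t1, t2]
    simp only [t3, t5]
    congr 2
    · rw [Finset.sum_comm]
      conv_rhs => rw [Finset.sum_comm]
      simp only [← Finset.sum_mul, t4]
    · rw [Finset.sum_comm]
      conv_rhs => rw [Finset.sum_comm]
      exact Finset.sum_congr rfl fun l _ => t6 _
  have hl : ricci G x i j = ric (fun k => R.mulVec (e k)) (R.mulVec (e i)) (R.mulVec (e j)) := by
    simp only [ric, ← h1, ← h2, e, tri_single, quad_single]
    rfl
  rw [hl, hframe, hric.eq_bi]
  congr 1
  funext a b
  simp only [ric, e, tri_single, quad_single]
  rfl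

end Isometry

/-! ### Rotations -/

lemma rot_mul_transpose (γ : ℝ) : rot γ * (rot γ).transpose = 1 := by
  have h := Real.sin_sq_add_cos_sq γ
  ext i j
  fin_cases i <;> fin_cases j <;>
    simp [rot, Matrix.mul_apply, Fin.sum_univ_three] <;> linarith

lemma rot_mulVec_meridian (γ α : ℝ) (q : ℝ × ℝ) :
    (rot γ).mulVec (meridian α q) = meridian (α + γ) q := by
  funext i
  fin_cases i <;>
    simp [rot, meridian, Matrix.mulVec, dotProduct, Fin.sum_univ_three, Real.cos_add,
      Real.sin_add] <;> ring

lemma rot_mulVec_eta (α : ℝ) (a : Fin 3) : ∑ i, (rot α a i : ℂ) * eta 0 i = eta α a := by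
  fin_cases a <;> simp [rot, eta, Fin.sum_univ_three] <;> ring

lemma rot_conj_phiHat (γ α : ℝ) : (rot γ).transpose *
    Matrix.vecMulVec (phiHat (α + γ)) (phiHat (α + γ)) * rot γ =
      Matrix.vecMulVec (phiHat α) (phiHat α) := by
  have h : (rot γ).transpose.mulVec (phiHat (α + γ)) = phiHat α := by
    have h := Real.sin_sq_add_cos_sq γ
    funext i
    fin_cases i
    · simp [rot, phiHat, Matrix.mulVec, dotProduct, Fin.sum_univ_three, Real.cos_add, Real.sin_add]
      linear_combination (-Real.sin α) * h
    · simp [rot, phiHat, Matrix.mulVec, dotProduct, Fin.sum_univ_three, Real.cos_add, Real.sin_add]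
      linear_combination (Real.cos α) * h
    · simp [rot, phiHat, Matrix.mulVec, dotProduct, Fin.sum_univ_three]
  rw [Matrix.mul_vecMulVec, Matrix.vecMulVec_mul, h, ← Matrix.mulVec_transpose, h]

section Axisymmetric

variable {U : Set (Fin 3 → ℝ)} {M : StationarySpacetime (U \ {0})} {A : ConformalCompletion U M}
  {κ β : (Fin 3 → ℝ) → ℝ}

lemma IsAxisymmetric.isLinearIsometry (hA : IsAxisymmetric A κ β) (γ : ℝ) :
    IsLinearIsometry U A.hT (rot γ) where
  orthogonal := rot_mul_transpose γ
  mapsTo := hA.domain γ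
  metric x hx := by
    have hRR : (rot γ).transpose * rot γ = 1 := mul_eq_one_comm.1 (rot_mul_transpose γ)
    have hκ := hA.κ_inv γ x hx
    have hβ := hA.β_inv γ x hx
    have hx' := hA.domain γ x hx
    obtain ⟨α, q, rfl⟩ := exists_eq_meridian x
    rw [rot_mulVec_meridian] at *
    rw [hA.hT_meridian α hx, hA.hT_meridian (α + γ) hx', hκ, hβ]
    simp only [Matrix.mul_smul, Matrix.smul_mul, mul_add, add_mul, mul_one, hRR, rot_conj_phiHat]

lemma IsAxisymmetric.etaRicci_eq (hA : IsAxisymmetric A κ β) (α : ℝ) {q : ℝ × ℝ}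
    (hq : q ∈ meridianDomain U 0) : A.etaRicci α q = A.etaRicci 0 q := by
  have h := (hA.isLinearIsometry α).ricci_eq A.isOpen A.hT_smooth
    (fun x hx => (A.hT_posDef x hx).det_pos.ne') (x := meridian 0 q) hq
  rw [rot_mulVec_meridian, zero_add] at h
  have hexp : ∀ (v : Fin 3 → ℂ) (T : Fin 3 → Fin 3 → ℂ),
      contract v (n := 2) (fun I => T (I 0) (I 1)) = ∑ i, ∑ j, v i * v j * T i j := by
    intro v T
    simp only [contract_succ, Finset.mul_sum]
    refine Finset.sum_congr rfl fun i _ => Finset.sum_congr rfl fun j _ => ?_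
    simp [contract, slice]
    ring
  simp only [ConformalCompletion.etaRicci]
  rw [hexp (eta α) fun i j => (ricci A.hT (meridian α q) i j : ℂ),
    hexp (eta 0) fun i j => (ricci A.hT (meridian 0 q) i j : ℂ)]
  simp only [h, bi, Matrix.mulVec_single_one, Matrix.col_apply]
  generalize ricci A.hT (meridian α q) = T
  simp only [← rot_mulVec_eta α]
  simp only [Fin.sum_univ_three]
  push_cast
  ring

/-! ### Rotation invariance of the rescaled potential -/

lemma rotST_mulVec_cons (γ : ℝ) (x : Fin 3 → ℝ) :
    (rotST γ).mulVec (Fin.cons 0 x) = (Fin.cons 0 ((rot γ).mulVec x) : Fin 4 → ℝ) := by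
  funext i
  refine Fin.cases ?_ (fun i => ?_) i
  · simp [rotST, Matrix.mulVec, dotProduct, Fin.sum_univ_four]
  · fin_cases i <;>
      simp [rotST, rot, Matrix.mulVec, dotProduct, Fin.sum_univ_succ]

/-- Invariance of `Ω` is not assumed. It follows from the `zz` component of `h̃ = Ω² h`: both
`h̃_zz` and `h_zz` are invariant, `h_zz ≠ 0`, and `Ω > 0`. -/
lemma IsAxisymmetric.phiT_inv (hA : IsAxisymmetric A κ β) (γ : ℝ) {x : Fin 3 → ℝ} (hx : x ∈ U) :
    A.phiT ((rot γ).mulVec x) = A.phiT x := by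
  by_cases h0 : x = 0
  · subst h0
    rw [Matrix.mulVec_zero]
  have hxV : x ∈ U \ {0} := ⟨hx, h0⟩
  have hRx : (rot γ).mulVec x ∈ U \ {0} := by
    refine ⟨hA.domain γ x hx, fun h => h0 ?_⟩
    have hRR : (rot γ).transpose * rot γ = 1 := mul_eq_one_comm.1 (rot_mul_transpose γ)
    rw [← Matrix.one_mulVec x, ← hRR, ← Matrix.mulVec_mulVec, show (rot γ).mulVec x = 0 from h,
      Matrix.mulVec_zero]
  have hg := hA.metric γ (Fin.cons 0 x) hxV
  rw [rotST_mulVec_cons] at hg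
  change (rotST γ).transpose * M.gAt ((rot γ).mulVec x) * rotST γ = M.gAt x at hg
  -- The `t` and `z̃` directions, indices `0` and `3`, are fixed by the rotation, and `λ` and `h_zz`
  -- involve only these components.
  have hcol : ∀ a b : Fin 4, (a = 0 ∨ a = 3) → (b = 0 ∨ b = 3) →
      M.gAt ((rot γ).mulVec x) a b = M.gAt x a b := by
    intro a b ha hb
    rw [← hg]
    rcases ha with rfl | rfl <;> rcases hb with rfl | rfl <;>
      simp [rotST, Matrix.mul_apply, Fin.sum_univ_four]
  have hlam : M.lam ((rot γ).mulVec x) = M.lam x := by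
    simp [StationarySpacetime.lam, xi, hcol 0 0 (.inl rfl) (.inl rfl)]
  have hh : M.h ((rot γ).mulVec x) 2 2 = M.h x 2 2 := by
    simp only [StationarySpacetime.h, Matrix.of_apply, hlam, xi, Matrix.mulVec_single_one,
      Matrix.col_apply]
    rw [show (2 : Fin 3).succ = (3 : Fin 4) from rfl, hcol 3 3 (.inr rfl) (.inr rfl),
      hcol 3 0 (.inr rfl) (.inl rfl)]
  have hT : A.hT ((rot γ).mulVec x) 2 2 = A.hT x 2 2 := by
    rw [(hA.isLinearIsometry γ).metric x hx]
    simp [rot, Matrix.mul_apply, Fin.sum_univ_three]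
  have hpos : 0 < A.hT x 2 2 := (A.hT_posDef x hx).diag_pos
  have hΩ : A.Ω ((rot γ).mulVec x) = A.Ω x := by
    rw [A.hT_eq x hxV, A.hT_eq _ hRx, Matrix.smul_apply, Matrix.smul_apply, hh] at hT
    rw [A.hT_eq x hxV, Matrix.smul_apply] at hpos
    have h22 : M.h x 2 2 ≠ 0 := fun h => by simp [h] at hpos
    exact (pow_left_inj₀ (A.Ω_pos _ hRx).le (A.Ω_pos _ hxV).le two_ne_zero).1
      (mul_right_cancel₀ h22 hT)
  have hpot : M.potential ((rot γ).mulVec x) = M.potential x := by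
    simp only [StationarySpacetime.potential, hlam, hA.omega γ x hxV]
  rw [A.phiT_eq _ hRx, A.phiT_eq _ hxV, hΩ, hpot]

/-! ### The scalars and the moments -/

lemma IsAxisymmetric.contDiffOn_P (hA : IsAxisymmetric A κ β) (n : ℕ) (I : Fin n → Fin 3) :
    ContDiffOn ℝ ∞ (fun x => A.P n x I) U :=
  hA.isSmoothFrame.contDiffOn_multipoleTensor A.isOpen A.phiT_smooth n I

lemma IsAxisymmetric.contDiffOn_f (hA : IsAxisymmetric A κ β) (α : ℝ) (n : ℕ) :
    ContDiffOn ℝ ∞ (A.f α n) (meridianDomain U α) :=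
  ContDiffOn.sum fun I _ => contDiffOn_const.mul
    ((hA.contDiffOn_P n I).comp (contDiff_meridian α).contDiffOn (mapsTo_meridian U α))

lemma IsAxisymmetric.contract_covDeriv_P (hA : IsAxisymmetric A κ β) (α : ℝ) (n : ℕ) {q : ℝ × ℝ}
    (hq : q ∈ meridianDomain U α) :
    contract (eta α) (covDeriv A.hT (A.P n) (meridian α q)) = etaD (A.f α n) q -
      2 * n * A.f α n q * etaD (fun q' => (κ (meridian α q') : ℂ)) q := by
  have hd : ∀ I, DifferentiableAt ℝ (fun y => A.P n y I) (meridian α q) := fun I =>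
    ((hA.contDiffOn_P n I).contDiffAt (A.isOpen.mem_nhds hq)).differentiableAt (by simp)
  have hκ : DifferentiableAt ℝ κ (meridian α q) :=
    (hA.κ_smooth.contDiffAt (A.isOpen.mem_nhds hq)).differentiableAt (by simp)
  have hF : DifferentiableAt ℝ (fun y => contract (eta α) (A.P n y)) (meridian α q) :=
    DifferentiableAt.fun_sum fun I _ => (hd I).const_mul _
  have hκ' : DifferentiableAt ℝ (fun y => (κ y : ℂ)) (meridian α q) :=
    Complex.ofRealCLM.differentiableAt.comp _ hκ
  rw [contract_covDeriv hd (hA.sum_christoffel_eta α hq), etaD_comp_meridian hκ',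
    ← etaD_comp_meridian hF]
  simp only [pderiv_ofReal hκ]
  change etaD (A.f α n) q - n * _ * A.f α n q = _
  ring

/-- For `n = 0` the truncated index `n - 1` is `0`, which is harmless since the coefficient `n (2n -
1)/2` vanishes. -/
theorem IsAxisymmetric.f_succ (hA : IsAxisymmetric A κ β) (α : ℝ) (n : ℕ) {q : ℝ × ℝ}
    (hq : q ∈ meridianDomain U α) :
    A.f α (n + 1) q = etaD (A.f α n) q -
      2 * n * A.f α n q * etaD (fun q' => (κ (meridian α q') : ℂ)) q -
      n * (2 * n - 1) / 2 * A.etaRicci α q * A.f α (n - 1) q := by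
  have hstf := fun (n : ℕ) (T : Tensor (Fin 3) ℂ n) =>
    ((hA.isSmoothFrame.isFrame _ hq).stfPart_spec T).contract_eq _ (hA.eta_null α hq)
  cases n with
  | zero =>
    have := hA.contract_covDeriv_P α 0 hq
    rw [ConformalCompletion.f, ConformalCompletion.P, multipoleTensor, hstf]
    change contract (eta α) (covDeriv A.hT (A.P 0) (meridian α q)) = _
    rw [this]
    simp
  | succ n =>
    have hc := hA.contract_covDeriv_P α (n + 1) hq
    have hsub : contract (eta α) (n := n + 2) (fun I =>
        (ricci A.hT (meridian α q) (I 0) (I 1) : ℂ) *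
        A.P n (meridian α q) (Fin.tail (Fin.tail I))) = A.etaRicci α q * A.f α n q := by
      simp only [ConformalCompletion.etaRicci, ConformalCompletion.f, contract_succ (n := n + 1),
        contract_succ (n := n), contract_succ (n := 1), contract_succ (n := 0), Finset.mul_sum,
        Finset.sum_mul]
      refine Finset.sum_congr rfl fun i _ => Finset.sum_congr rfl fun j _ => ?_
      have : slice j (slice i (fun I : Fin (n + 2) → Fin 3 =>
          (ricci A.hT (meridian α q) (I 0) (I 1) : ℂ) *
            A.P n (meridian α q) (Fin.tail (Fin.tail I)))) =
          (ricci A.hT (meridian α q) i j : ℂ) • A.P n (meridian α q) := by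
        funext I
        rfl
      rw [this, contract_smul]
      simp [contract, slice]
      ring
    rw [ConformalCompletion.f, ConformalCompletion.P, multipoleTensor, hstf]
    have hsplit : (fun I : Fin (n + 2) → Fin 3 =>
        covDeriv A.hT (multipoleTensor A.hT A.phiT (n + 1)) (meridian α q) I -
          (((n : ℂ) + 1) * (2 * n + 1) / 2) * (ricci A.hT (meridian α q) (I 0) (I 1) : ℂ) *
            multipoleTensor A.hT A.phiT n (meridian α q) (Fin.tail (Fin.tail I))) =
        covDeriv A.hT (A.P (n + 1)) (meridian α q) - (((n : ℂ) + 1) * (2 * n + 1) / 2) •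
          (fun I : Fin (n + 2) → Fin 3 => (ricci A.hT (meridian α q) (I 0) (I 1) : ℂ) *
            A.P n (meridian α q) (Fin.tail (Fin.tail I))) := by
      funext I
      simp only [Pi.sub_apply, Pi.smul_apply, smul_eq_mul, ← mul_assoc]
      rfl
    rw [hsplit, contract_sub, contract_smul, hc, hsub]
    simp only [Nat.add_sub_cancel]
    push_cast
    ring

lemma etaD_congr {F H : ℝ × ℝ → ℂ} {s : Set (ℝ × ℝ)} (hs : IsOpen s) (h : Set.EqOn F H s)
    {q : ℝ × ℝ} (hq : q ∈ s) : etaD F q = etaD H q := by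
  have : F =ᶠ[nhds q] H := by filter_upwards [hs.mem_nhds hq] with y hy using h hy
  rw [etaD, etaD, this.fderiv_eq]

lemma IsAxisymmetric.meridianDomain_eq (hA : IsAxisymmetric A κ β) (α : ℝ) :
    meridianDomain U α = meridianDomain U 0 := by
  ext q
  constructor
  · intro hq
    have := hA.domain (-α) _ hq
    rwa [rot_mulVec_meridian, add_neg_cancel] at this
  · intro hq
    have := hA.domain α _ hq
    rwa [rot_mulVec_meridian, zero_add] at this

/-- The recursion has the same coefficients at every angle; equality on an open set is what allows
`etaD` to be compared. -/
theorem IsAxisymmetric.f_eq (hA : IsAxisymmetric A κ β) (α : ℝ) (n : ℕ) :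
    Set.EqOn (A.f α n) (A.f 0 n) (meridianDomain U 0) := by
  have hopen := isOpen_meridianDomain A.isOpen 0
  induction n using Nat.strong_induction_on with
  | _ n ih =>
    cases n with
    | zero =>
      intro q hq
      have h := hA.phiT_inv α (x := meridian 0 q) hq
      rw [rot_mulVec_meridian, zero_add] at h
      simpa [ConformalCompletion.f, contract, ConformalCompletion.P, multipoleTensor] using h
    | succ n =>
      intro q hq
      have hκ : Set.EqOn (fun q' => (κ (meridian α q') : ℂ)) (fun q' => (κ (meridian 0 q') : ℂ))
          (meridianDomain U 0) := by
        intro q hq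
        have h := hA.κ_inv α (meridian 0 q) hq
        rw [rot_mulVec_meridian, zero_add] at h
        simp only [h]
      rw [hA.f_succ α n (by rwa [hA.meridianDomain_eq]), hA.f_succ 0 n hq, hA.etaRicci_eq α hq,
        etaD_congr hopen (ih n (by omega)) hq, etaD_congr hopen hκ hq, ih n (by omega) hq,
        ih (n - 1) (by omega) hq]

lemma IsAxisymmetric.isSymmetric_P (hA : IsAxisymmetric A κ β) (n : ℕ) {x : Fin 3 → ℝ}
    (hx : x ∈ U) : IsSymmetric (A.P n x) ∧ IsTraceFree (A.hT x) (A.P n x) := by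
  have hstf := fun (n : ℕ) (T : Tensor (Fin 3) ℂ n) =>
    (hA.isSmoothFrame.isFrame _ hx).stfPart_spec T
  match n with
  | 0 => exact ⟨fun _ _ => rfl, fun a => a.elim0⟩
  | 1 => exact ⟨(hstf _ _).1, (hstf _ _).2.1⟩
  | n + 2 => exact ⟨(hstf _ _).1, (hstf _ _).2.1⟩

lemma contract_prod_dZ (α : ℝ) (n : ℕ) :
    contract (eta α) (fun I : Fin n → Fin 3 => ∏ k, (dZ (I k) : ℂ)) = 1 := by
  induction n with
  | zero => simp [contract]
  | succ n ih =>
    rw [contract_succ]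
    have : ∀ i, slice i (fun I : Fin (n + 1) → Fin 3 => ∏ k, (dZ (I k) : ℂ)) =
        (dZ i : ℂ) • fun I : Fin n → Fin 3 => ∏ k, (dZ (I k) : ℂ) := by
      intro i
      funext I
      simp [slice, Fin.prod_univ_succ]
    simp only [this, contract_smul, ih]
    simp [Fin.sum_univ_three, eta, dZ]

theorem IsAxisymmetric.isMoment_iff (hA : IsAxisymmetric A κ β) (α : ℝ) (n : ℕ) (m : ℂ) :
    A.IsMoment n m ↔ m = A.f α n (0, 0) := by
  have hm : ∀ α, meridian α (0, 0) = 0 := fun α => by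
    funext i
    fin_cases i <;> simp [meridian]
  have h0 : ((0 : ℝ), (0 : ℝ)) ∈ meridianDomain U 0 := by
    change meridian 0 (0, 0) ∈ U
    rw [hm]
    exact A.mem_zero
  -- Here angle independence enters: at `Λ` the tensor is the same for all planes, so `f_eq` fixes
  -- its contractions with the whole family `η`.
  have hf : ∀ γ, contract (eta γ) (A.P n 0) = A.f α n (0, 0) := by
    intro γ
    rw [hA.f_eq α n h0, ← hA.f_eq γ n h0, ConformalCompletion.f, hm]
  have hC := stfPart_one_spec (fun I : Fin n → Fin 3 => ∏ k, (dZ (I k) : ℂ))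
  have hCη : ∀ γ, contract (eta γ) (stfPart 1 fun I : Fin n → Fin 3 => ∏ k, (dZ (I k) : ℂ)) = 1 :=
    fun γ => by rw [hC.contract_eq _ (GerochHansen.eta_null γ), contract_prod_dZ]
  rw [ConformalCompletion.IsMoment, hA.hT_zero]
  constructor
  · intro h
    rw [← hf 0, h, contract_smul, hCη, mul_one]
  · rintro rfl
    have hP := hA.isSymmetric_P n A.mem_zero
    rw [hA.hT_zero] at hP
    refine sub_eq_zero.1 (eq_zero_of_contract_eta (hP.1.sub (hC.1.smul _))
      (hP.2.sub (hC.2.1.smul _)) fun γ => ?_)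
    rw [contract_sub, contract_smul, hCη, hf, mul_one, sub_self]

end Axisymmetric

end GerochHansen

theorem mainTheorem1 {U : Set (Fin 3 → ℝ)} {M : GerochHansen.StationarySpacetime (U \ {0})}
    (A : GerochHansen.ConformalCompletion U M) (κ β : (Fin 3 → ℝ) → ℝ)
    (hA : GerochHansen.IsAxisymmetric A κ β) :
    -- the scalars are smooth functions of `(z̃, ρ̃)`, the same on all meridian planes
    (∀ (α : ℝ) (n : ℕ),
      ContDiffOn ℝ (⊤ : ℕ∞) (A.f α n) (GerochHansen.meridianDomain U α)) ∧
    (∀ (α : ℝ) (n : ℕ), ∀ q ∈ GerochHansen.meridianDomain U α, A.f α n q = A.f 0 n q) ∧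
    -- the recursion; for `n = 1` the last coefficient is zero
    (∀ (α : ℝ) (n : ℕ), 1 ≤ n → ∀ q ∈ GerochHansen.meridianDomain U α,
      A.f α n q =
        GerochHansen.etaD (A.f α (n - 1)) q
        - 2 * ((n : ℂ) - 1) * A.f α (n - 1) q *
            GerochHansen.etaD (fun q' => (κ (GerochHansen.meridian α q') : ℂ)) q
        - ((n : ℂ) - 1) * (2 * (n : ℂ) - 3) / 2 * A.etaRicci α q * A.f α (n - 2) q) ∧
    -- the moment `mₙ` exists, is unique, and equals `fₙ(Λ)`
    (∀ (α : ℝ) (n : ℕ) (m : ℂ), A.IsMoment n m ↔ m = A.f α n (0, 0)) := by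
  refine ⟨hA.contDiffOn_f, fun α n q hq => ?_, fun α n hn q hq => ?_, hA.isMoment_iff⟩
  · rw [hA.meridianDomain_eq] at hq
    exact hA.f_eq α n hq
  · obtain ⟨n, rfl⟩ := Nat.exists_eq_add_of_le' hn
    rw [hA.f_succ α n hq, Nat.add_sub_cancel, show n + 1 - 2 = n - 1 by omega]
    push_cast
    ring
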